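/- Let $\mathsf k$ be an algebraically closed field and let $n\ge 3$ and $1\le q\le n-1$ be integers. Identify $H^0(\mathbb P^n,\Omega^q_{\mathbb P^n}(d+q+1))$ with the space of homogeneous polynomial $q$-forms on $\mathbb A^{n+1}$ whose coefficients have degree $d+1$ and which are annihilated by the radial vector field $R=\sum x_i\,\partial/\partial x_i$ (projective $q$-forms). Let $\mathrm{Fol}^q(d,n)\subset\mathbb P H^0(\mathbb P^n,\Omega^q_{\mathbb P^n}(d+q+1))$, the space of codimension $q$ foliations of degree $d$ on $\mathbb P^n$, be the set of classes $[\omega]$ such that the zero locus of $\omega$ in $\mathbb P^n$ has codimension at least $2$ and $i_v\omega\wedge\omega=0$, $i_v\omega\wedge d\omega=0$ for every $v\in\bigwedge^{q-1}\mathsf k^{n+1}$; it is considered with its reduced structure. Write $\mathrm{Fol}(d,n)=\mathrm{Fol}^1(d,n)$, and let $\mathrm{Closed}(d,n)\subset\mathrm{Fol}(d,n)$ be the set of foliations defined by closed projective $1$-forms. Say that $[\omega]$ is defined by the linear projection $\mathbb P^n\dashrightarrow\mathbb P^q$ induced by a surjective linear map $\pi:\mathsf k^{n+1}\to\mathsf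 k^{q+1}$ if, off the centre $\mathbb P(\ker\pi)$, the kernel of $\omega$ is the kernel of the differential of the projection. 1. Suppose that $\operatorname{char}\mathsf k\ne 2$ or $q>1$. Then a point $[\omega]\in\mathbb P H^0(\mathbb P^n,\Omega^q_{\mathbb P^n}(q+1))$ belongs to $\mathrm{Fol}^q(0,n)$ if and only if it is defined by a linear projection $\mathbb P^n\dashrightarrow\mathbb P^q$. Moreover, there is an isomorphism of varieties from $\mathrm{Fol}^q(0,n)$ to the Grassmannian of linear subspaces of codimension $q+1$ of $\mathbb P^n$ under which $[\omega]$ corresponds to the centre of the linear projections defining it: $[\omega]$ is defined by the projection induced by $\pi$ if and only if its image is $\mathbb P(\ker\pi)$. 2. If $\operatorname{char}\mathsf k=2$ and $q=1$, then $\mathrm{Fol}(0,n)=\mathbb P H^0(\mathbb P^n,\Omega^1_{\mathbb P^n}(2))=\mathrm{Closed}(0,n)$. 3. In all cases, $\mathrm{Fol}^q(0,n)$ is locally closed in $\mathbb P H^0(\mathbb P^n,\Omega^q_{\mathbb P^n}(q+1))$ and, with its reduced structure, it is a smooth and irreducible algebraic variety. -/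

import Mathlib

open scoped LinearAlgebra.Projectivization

noncomputable section

/-! ## Quasi-projective varieties over an algebraically closed field

A reduced scheme that is locally closed in a projective space is identified with the set of its
closed points, with the Zariski topology and the sheaf of regular functions. -/

namespace ProjVar

variable {k : Type*} [Field k] {W : Type*} [AddCommGroup W] [Module k W]

/-- The value at `w : W` of a polynomial expression in linear functionals on `W`. -/
def evalAt (F : MvPolynomial (Module.Dual k W) k) (w : W) : k :=
  MvPolynomial.eval (fun l => l w) F

/-- The Zariski topology on `ℙ k W`: the complements of the zero loci of homogeneous polynomials
in the linear coordinates form a basis of it (two of them meet in the one of the product). -/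
instance zariskiTopology : TopologicalSpace (ℙ k W) :=
  TopologicalSpace.generateFrom
    {U | ∃ (m : ℕ) (F : MvPolynomial (Module.Dual k W) k),
      F.IsHomogeneous m ∧ U = {p | evalAt F p.rep ≠ 0}}

variable {Y : Set (ℙ k W)}

/-- `f` is a regular function on `U ⊆ Y`: near each point of `U` it is a quotient of two
homogeneous polynomials of the same degree, with non-vanishing denominator. -/
def IsRegularOn (U : Set Y) (f : Y → k) : Prop :=
  ∀ y ∈ U, ∃ O : Set Y, IsOpen O ∧ y ∈ O ∧
    ∃ (m : ℕ) (F G : MvPolynomial (Module.Dual k W) k), F.IsHomogeneous m ∧ G.IsHomogeneous m ∧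
      ∀ z ∈ O ∩ U, evalAt G z.1.rep ≠ 0 ∧ f z = evalAt F z.1.rep / evalAt G z.1.rep

variable {W' : Type*} [AddCommGroup W'] [Module k W'] {Y' : Set (ℙ k W')}

/-- Morphisms of varieties: continuous maps that pull regular functions on open sets back to
regular functions. -/
def IsMorphism (φ : Y → Y') : Prop :=
  Continuous φ ∧ ∀ (U : Set Y') (f : Y' → k), IsOpen U → IsRegularOn U f →
    IsRegularOn (φ ⁻¹' U) (f ∘ φ)

/-- Isomorphisms of varieties. -/
def IsIsomorphism (e : Y ≃ Y') : Prop :=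
  IsMorphism e ∧ IsMorphism e.symm

/-- The local ring of `Y` at `y`: the ring of germs at `y` of regular functions, as a subring of
the ring of germs at `y` of all `k`-valued functions on `Y`. -/
def localRing (y : Y) : Subring (Filter.Germ (nhds y) k) where
  carrier := {g | ∃ (m : ℕ) (F G : MvPolynomial (Module.Dual k W) k),
    F.IsHomogeneous m ∧ G.IsHomogeneous m ∧ evalAt G y.1.rep ≠ 0 ∧
      g = ((fun z : Y => evalAt F z.1.rep / evalAt G z.1.rep : Y → k) : Filter.Germ (nhds y) k)}
  one_mem' := ⟨0, 1, 1, MvPolynomial.isHomogeneous_one _ _, MvPolynomial.isHomogeneous_one _ _,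
    by simp [evalAt], by simp [evalAt]; rfl⟩
  zero_mem' := ⟨0, 0, 1, MvPolynomial.isHomogeneous_zero _ _ _, MvPolynomial.isHomogeneous_one _ _,
    by simp [evalAt], by simp [evalAt]; rfl⟩
  neg_mem' := by
    rintro _ ⟨m, F, G, hF, hG, hy, rfl⟩
    refine ⟨m, -F, G, hF.neg, hG, hy, ?_⟩
    rw [← Filter.Germ.coe_neg]
    congr 1
    funext z
    simp [evalAt, neg_div]
  mul_mem' := by
    rintro _ _ ⟨m, F, G, hF, hG, hy, rfl⟩ ⟨m', F', G', hF', hG', hy', rfl⟩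
    refine ⟨m + m', F * F', G * G', hF.mul hF', hG.mul hG', ?_, ?_⟩
    · simpa [evalAt] using ⟨hy, hy'⟩
    · rw [← Filter.Germ.coe_mul]
      congr 1
      funext z
      simp [evalAt, div_mul_div_comm]
  add_mem' := by
    rintro _ _ ⟨m, F, G, hF, hG, hy, rfl⟩ ⟨m', F', G', hF', hG', hy', rfl⟩
    have key : ∀ (m : ℕ) (G : MvPolynomial (Module.Dual k W) k), G.IsHomogeneous m →
        evalAt G y.1.rep ≠ 0 → ∀ᶠ z : Y in nhds y, evalAt G z.1.rep ≠ 0 := by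
      intro m G hG hy
      have ho : IsOpen {p : ℙ k W | evalAt G p.rep ≠ 0} :=
        TopologicalSpace.isOpen_generateFrom_of_mem ⟨m, G, hG, rfl⟩
      exact (ho.preimage continuous_subtype_val).mem_nhds hy
    refine ⟨m + m', F * G' + G * F', G * G', (hF.mul hG').add (hG.mul hF'), hG.mul hG', ?_, ?_⟩
    · simpa [evalAt] using ⟨hy, hy'⟩
    · rw [← Filter.Germ.coe_add]
      refine Filter.Germ.coe_eq.mpr ?_
      filter_upwards [key m G hG hy, key m' G' hG' hy'] with z h h'
      simp only [Pi.add_apply]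
      rw [div_add_div _ _ h h']
      simp [evalAt]

/-- A variety over an algebraically closed field is smooth if its local rings at closed points
are regular. -/
def IsSmooth (Y : Set (ℙ k W)) : Prop :=
  ∀ y : Y, IsRegularLocalRing (localRing y)

/-- A closed subset `Z` of a topological space has codimension at least two: above every
irreducible closed `C ⊆ Z` there is a chain of irreducible closed sets of length two. -/
def CodimGeTwo {X : Type*} [TopologicalSpace X] (Z : Set X) : Prop :=
  ∀ C : TopologicalSpace.IrreducibleCloseds X, (C : Set X) ⊆ Z → 2 ≤ Order.coheight C

variable (k)

/-- `p` is the Plücker point `[v₁ ∧ ⋯ ∧ vₘ]` of the subspace `L` with basis `v₁, …, vₘ`. -/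
def IsPluckerPoint {m : ℕ} (p : ℙ k (⋀[k]^m W)) (L : Submodule k W) : Prop :=
  ∃ v : Fin m → W, LinearIndependent k v ∧ Submodule.span k (Set.range v) = L ∧
    p.submodule = Submodule.span k {exteriorPower.ιMulti k m v}

variable (W)

/-- The Grassmannian of `m`-dimensional linear subspaces of `W`, in its Plücker embedding. -/
def grassmannian (m : ℕ) : Set (ℙ k (⋀[k]^m W)) :=
  {p | ∃ L : Submodule k W, IsPluckerPoint k p L}

end ProjVar

/-! ## Polynomial differential forms on affine space and foliations on projective space -/

namespace Foliation

variable (k : Type*) [Field k] (n : ℕ)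

/-- Polynomial `q`-forms `∑ a_I dx_I` on `𝔸ⁿ⁺¹`, given by their values on constant vector fields;
`a_I` is the value on the coordinate fields `∂/∂x_i`, `i ∈ I`. -/
abbrev Form (q : ℕ) : Type _ :=
  (Fin (n + 1) → k) [⋀^Fin q]→ₗ[k] MvPolynomial (Fin (n + 1)) k

variable {k n} {q : ℕ}

/-- The `1`-form obtained by filling all slots of `ω` but the `i`-th with the constant vectors
`v j`, `j ≠ i` (the vector `v i` is not used). Up to sign this is `i_u ω` for the
`(q-1)`-vector `u` that is the wedge product of these vectors, and such `u` span the
`(q-1)`-vectors. For `q = 1` it is `ω`. -/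
def contractExcept (ω : Form k n q) (v : Fin q → Fin (n + 1) → k) (i : Fin q) :
    (Fin (n + 1) → k) →ₗ[k] MvPolynomial (Fin (n + 1)) k :=
  ω.toMultilinearMap.toLinearMap v i

/-- The exterior product `α ∧ η` of a `1`-form and an `r`-form,
`(α ∧ η)(v₀, …, v_r) = ∑ (-1)ⁱ α(v_i) η(v₀, …, v̂_i, …, v_r)`. -/
def wedgeOne {r : ℕ} (α : (Fin (n + 1) → k) →ₗ[k] MvPolynomial (Fin (n + 1)) k) (η : Form k n r) :
    Form k n (r + 1) :=
  AlternatingMap.alternatizeUncurryFin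
    { toFun := fun v => α v • η
      map_add' := fun v w => by rw [map_add, add_smul]
      map_smul' := fun c v => by ext; simp }

/-- The derivative `∑ v_j ∂/∂x_j` of polynomials in the direction of a constant vector `v`. -/
def dirDeriv : (Fin (n + 1) → k) →ₗ[k]
    MvPolynomial (Fin (n + 1)) k →ₗ[k] MvPolynomial (Fin (n + 1)) k :=
  ∑ j, (LinearMap.proj j : (Fin (n + 1) → k) →ₗ[k] k).smulRight
    (MvPolynomial.pderiv j : Derivation k _ _).toLinearMap

/-- The exterior derivative,
`dω(v₀, …, v_q) = ∑ (-1)ⁱ ∂_{v_i} (ω(v₀, …, v̂_i, …, v_q))` on constant vector fields. -/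
def extD (ω : Form k n q) : Form k n (q + 1) :=
  AlternatingMap.alternatizeUncurryFin
    { toFun := fun v => (dirDeriv v).compAlternatingMap ω
      map_add' := fun v w => by ext; simp
      map_smul' := fun c v => by ext; simp }

variable (k n) in
/-- `H⁰(ℙⁿ, Ω^q(d+q+1))`: the homogeneous `q`-forms on `𝔸ⁿ⁺¹` with coefficients of degree `d+1`
that are annihilated by the radial vector field `∑ x_j ∂/∂x_j`. -/
def projForms (q d : ℕ) : Submodule k (Form k n q) where
  carrier := {ω | (∀ v, (ω v).IsHomogeneous (d + 1)) ∧
    ∀ v i, ∑ j, MvPolynomial.X j * contractExcept ω v i (Pi.single j 1) = 0}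
  zero_mem' := ⟨fun _ => MvPolynomial.isHomogeneous_zero _ _ _, fun v i => by
    simp [contractExcept]⟩
  add_mem' := by
    rintro a b ⟨ha, ha'⟩ ⟨hb, hb'⟩
    refine ⟨fun v => (ha v).add (hb v), fun v i => ?_⟩
    have h := congrArg₂ (· + ·) (ha' v i) (hb' v i)
    simpa [contractExcept, mul_add, Finset.sum_add_distrib] using h
  smul_mem' := by
    rintro c a ⟨ha, ha'⟩
    refine ⟨fun v => ?_, fun v i => ?_⟩
    · rw [AlternatingMap.smul_apply, MvPolynomial.smul_eq_C_mul]
      simpa using (MvPolynomial.isHomogeneous_C _ c).mul (ha v)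
    · have h := congrArg (c • ·) (ha' v i)
      simpa [contractExcept, Finset.smul_sum] using h

/-- The singular set of `ω` in `ℙⁿ`: the common zeros of its coefficients. -/
def sing (ω : Form k n q) : Set (ℙ k (Fin (n + 1) → k)) :=
  {x | ∀ v, MvPolynomial.eval x.rep (ω v) = 0}

/-- Plücker's equations `i_u ω ∧ ω = 0` for all `(q-1)`-vectors `u`. -/
def IsLocallyDecomposable (ω : Form k n q) : Prop :=
  ∀ v i, wedgeOne (contractExcept ω v i) ω = 0

/-- The integrability equations `i_u ω ∧ dω = 0` for all `(q-1)`-vectors `u`. -/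
def SatisfiesIntegrability (ω : Form k n q) : Prop :=
  ∀ v i, wedgeOne (contractExcept ω v i) (extD ω) = 0

variable (k n) in
/-- The space `Fol^q(d, n)` of codimension `q` foliations of degree `d` on `ℙⁿ`, as a
subset of `ℙ H⁰(ℙⁿ, Ω^q(d+q+1))`. -/
def Fol (q d : ℕ) : Set (ℙ k (projForms k n q d)) :=
  {p | ProjVar.CodimGeTwo (sing (p.rep : Form k n q)) ∧
    IsLocallyDecomposable (p.rep : Form k n q) ∧ SatisfiesIntegrability (p.rep : Form k n q)}

variable (k n) in
/-- The space `Closed(d, n)` of the codimension one foliations of degree `d` on `ℙⁿ` that are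
defined by closed projective `1`-forms. -/
def ClosedFol (d : ℕ) : Set (ℙ k (projForms k n 1 d)) :=
  {p | p ∈ Fol k n 1 d ∧ extD (p.rep : Form k n 1) = 0}

/-- The kernel `{v | i_v ω = 0}` of `ω` at the point `x ∈ 𝔸ⁿ⁺¹`. -/
def kernelAt (ω : Form k n q) (x : Fin (n + 1) → k) : Submodule k (Fin (n + 1) → k) :=
  ⨅ w, ⨅ i, LinearMap.ker ((MvPolynomial.aeval x).toLinearMap ∘ₗ contractExcept ω w i)

/-- The distribution given by `ω` is the one given by the linear projection `ℙⁿ ⇢ ℙ^q` that is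
induced by `π`: at all points `x` off the centre `π = 0`, the kernel of `ω` is that of the
differential of the projection. As the tangent spaces of `ℙⁿ` at `[x]` and of `ℙ^q` at `[π x]` are
`kⁿ⁺¹ / k x` and `k^(q+1) / k (π x)` up to a twist, the latter kernel consists of the classes of
the `v` with `π v ∈ k (π x)`. -/
def IsDefinedByProjection (ω : Form k n q) (π : (Fin (n + 1) → k) →ₗ[k] (Fin (q + 1) → k)) : Prop :=
  ∀ x, π x ≠ 0 → kernelAt ω x = (Submodule.span k {π x}).comap π

end Foliation

end

/-!
The foliations of degree zero are classified by linear algebra. A projective `q`-form `ω` with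
linear coefficients is the contraction of a unique constant `(q + 1)`-form `θ` with the radial
vector field, `ω_x(v) = θ(x, v)` (`Foliation.constantFormEquiv`), and `dω = (q + 1) θ`. The zero
locus of `ω` is the projective space of the radical of `θ`. As a nonzero form in `q + 1` variables
has a radical of codimension at least `q + 1` (`AlternatingMap.card_le_finrank_quotient_radical`),
the condition on the singular set always holds, and equality means that `θ` is decomposable.

If `q + 1` is invertible in `k`, the integrability equations are Plücker's relations for `θ`, and
`θ` is decomposable (`AlternatingMap.ker_frameForms_le_radical_of_plucker`). If `q ≥ 2`, it
suffices that all contractions of `θ` with vectors satisfy Plücker's relations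
(`AlternatingMap.ker_frameForms_le_radical_of_plucker_curryLeft`): for a frame `e` with `θ(e) = 1`
and a vector `v` with `θ(e₀, …, v, …) = 0` for all places of `v`, the relations for the contraction
with `eᵢ` give `θ(eᵢ, v, …) = 0`, and those for the contraction with `e₀ + z` then give
`θ(z, v, …) = 0` for all `z`. One of the two cases applies unless `q = 1` and the characteristic is
two; there, all equations hold for trivial reasons and all projective forms are closed.

A form `ω` is defined by a projection `π` if and only if the radical of `θ` is the kernel of `π`
(`Foliation.isDefinedByProjection_radialContraction_iff`), because the kernel of `ω` at `x` is the
radical of the contraction of `θ` with `x`, whose codimension is at least `q`. The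
linear isomorphism `v₁ ∧ ⋯ ∧ vₘ ↦ (w ↦ det (v, w))`, with `m = n - q`, identifies the Plücker point
of a subspace with the class of the forms that have this subspace as their radical, so that it
restricts to an isomorphism between the Grassmannian and the space of foliations
(`Foliation.exists_isIsomorphism_grassmannian`).

The space of foliations is closed since it is given by quadratic equations, and irreducible since
it is parametrized by matrices (`ProjVar.isIrreducible_of_isPolynomialMap`). It is smooth since the
usual affine charts of the Grassmannian, in which a frame form is a matrix with a unit submatrix,
identify its local rings with localizations of polynomial rings
(`ProjVar.isRegularLocalRing_localRing_of_chart`).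
-/

/-! ### The radical of an alternating map -/

namespace AlternatingMap

variable {k V N : Type*} [Field k] [AddCommGroup V] [Module k V] [AddCommGroup N] [Module k N]

section Radical

variable {ι : Type*} [DecidableEq ι]

/-- The radical of an alternating map: the vectors that make it vanish when put in any slot. -/
def radical (A : V [⋀^ι]→ₗ[k] N) : Submodule k V :=
  ⨅ w, ⨅ i, LinearMap.ker (A.toMultilinearMap.toLinearMap w i)

lemma mem_radical {A : V [⋀^ι]→ₗ[k] N} {v : V} :
    v ∈ A.radical ↔ ∀ w i, A (Function.update w i v) = 0 := by
  simp [radical, Submodule.mem_iInf]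

lemma apply_eq_zero_of_mem_radical {A : V [⋀^ι]→ₗ[k] N} {u : ι → V} (i : ι)
    (h : u i ∈ A.radical) : A u = 0 := by
  have := mem_radical.1 h u i
  rwa [Function.update_eq_self] at this

lemma apply_eq_of_sub_mem_radical [Finite ι] (A : V [⋀^ι]→ₗ[k] N) {v v' : ι → V}
    (h : ∀ i, v i - v' i ∈ A.radical) : A v = A v' := by
  classical
  have := Fintype.ofFinite ι
  have key : ∀ S : Finset ι, A (S.piecewise v v') = A v' := by
    intro S
    induction S using Finset.induction with
    | empty => simp
    | insert i S hi ih =>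
      rw [Finset.piecewise_insert, ← ih, ← sub_eq_zero]
      have h1 : A (S.piecewise v v') =
          A (Function.update (S.piecewise v v') i (v' i)) := by
        congr 1
        rw [eq_comm, Function.update_eq_self_iff]
        simp [hi]
      rw [h1, ← A.map_update_sub]
      exact mem_radical.1 (h i) _ _
  simpa using key Finset.univ

lemma eq_compLinearMap_mkQ [Finite ι] (A : V [⋀^ι]→ₗ[k] N) {K : Submodule k V}
    (hK : K ≤ A.radical) {s : (V ⧸ K) →ₗ[k] V} (hs : K.mkQ ∘ₗ s = LinearMap.id) :
    A = (A.compLinearMap s).compLinearMap K.mkQ := by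
  ext v
  refine A.apply_eq_of_sub_mem_radical fun i => hK ?_
  rw [← Submodule.Quotient.mk_eq_zero, Submodule.Quotient.mk_sub, sub_eq_zero]
  exact (LinearMap.congr_fun hs _).symm

/-- An alternating map in more variables than the codimension of a subspace of its radical is
zero. -/
lemma eq_zero_of_finrank_lt [Fintype ι] [FiniteDimensional k V] (A : V [⋀^ι]→ₗ[k] N)
    {K : Submodule k V} (hK : K ≤ A.radical)
    (h : Module.finrank k (V ⧸ K) < Fintype.card ι) : A = 0 := by
  obtain ⟨s, hs⟩ := K.mkQ.exists_rightInverse_of_surjective K.range_mkQ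
  rw [A.eq_compLinearMap_mkQ hK hs]
  ext v
  rw [compLinearMap_apply, zero_apply]
  refine map_linearDependent _ _ fun hli => ?_
  exact absurd hli.fintype_card_le_finrank (not_le.2 h)

lemma card_le_finrank_quotient_radical [Fintype ι] [FiniteDimensional k V]
    {A : V [⋀^ι]→ₗ[k] N} (hA : A ≠ 0) : Fintype.card ι ≤ Module.finrank k (V ⧸ A.radical) := by
  by_contra h
  exact hA (A.eq_zero_of_finrank_lt le_rfl (not_le.1 h))

/-- Alternating forms in as many variables as the codimension of a common subspace of their
radicals are proportional. -/
lemma exists_eq_smul [Fintype ι] [FiniteDimensional k V] (A : V [⋀^ι]→ₗ[k] k)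
    {B : V [⋀^ι]→ₗ[k] k} (hB : B ≠ 0) {K : Submodule k V} (hA : K ≤ A.radical)
    (hB' : K ≤ B.radical) (h : Module.finrank k (V ⧸ K) = Fintype.card ι) :
    ∃ c : k, A = c • B := by
  obtain ⟨s, hs⟩ := K.mkQ.exists_rightInverse_of_surjective K.range_mkQ
  let b : Module.Basis ι k (V ⧸ K) := (Module.finBasisOfFinrankEq k _ h).reindex
    (Fintype.equivFin ι).symm
  have e1 := (A.compLinearMap s).eq_smul_basis_det b
  have e2 := (B.compLinearMap s).eq_smul_basis_det b
  have hA1 := A.eq_compLinearMap_mkQ hA hs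
  have hB1 := B.eq_compLinearMap_mkQ hB' hs
  have hc : B.compLinearMap s b ≠ 0 := by
    intro h0
    rw [h0, zero_smul] at e2
    rw [e2] at hB1
    exact hB (by rw [hB1]; ext; simp)
  obtain ⟨c, hc⟩ : ∃ c : k, A.compLinearMap s = c • B.compLinearMap s := by
    refine ⟨A.compLinearMap s b / B.compLinearMap s b, e1.trans ?_⟩
    calc A.compLinearMap s b • b.det
        = (A.compLinearMap s b / B.compLinearMap s b) • B.compLinearMap s b • b.det := by
          rw [smul_smul, div_mul_cancel₀ _ hc]
      _ = _ := congrArg _ e2.symm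
  refine ⟨c, hA1.trans ?_⟩
  rw [hc]
  exact congrArg (c • ·) hB1.symm

lemma radical_smul {c : k} (hc : c ≠ 0) (A : V [⋀^ι]→ₗ[k] N) :
    (c • A).radical = A.radical := by
  ext v
  simp [mem_radical, hc]

lemma ker_le_radical_compLinearMap {V' : Type*} [AddCommGroup V'] [Module k V']
    (A : V' [⋀^ι]→ₗ[k] N) (f : V →ₗ[k] V') : LinearMap.ker f ≤ (A.compLinearMap f).radical := by
  intro v hv
  refine mem_radical.2 fun w i => ?_
  rw [compLinearMap_apply]
  exact A.map_coord_zero i (by simpa using hv)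

end Radical

lemma mem_radical_iff_cons {m : ℕ} {A : V [⋀^Fin (m + 1)]→ₗ[k] N} {v : V} :
    v ∈ A.radical ↔ ∀ w, A (Matrix.vecCons v w) = 0 := by
  refine ⟨fun h w => apply_eq_zero_of_mem_radical 0 (by simpa using h), fun h => ?_⟩
  refine mem_radical.2 fun w i => ?_
  rw [← Fin.insertNth_removeNth, map_insertNth, h, smul_zero]

lemma radical_le_radical_curryLeft {m : ℕ} (A : V [⋀^Fin (m + 1)]→ₗ[k] N) (x : V) :
    A.radical ≤ (A.curryLeft x).radical := by
  intro v hv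
  refine mem_radical.2 fun w i => ?_
  rw [curryLeft_apply_apply]
  exact apply_eq_zero_of_mem_radical i.succ (by simpa using hv)

lemma mem_radical_curryLeft_self {m : ℕ} (A : V [⋀^Fin (m + 1)]→ₗ[k] N) (x : V) :
    x ∈ (A.curryLeft x).radical := by
  refine mem_radical.2 fun w i => ?_
  rw [curryLeft_apply_apply]
  exact A.map_eq_zero_of_eq _ (i := 0) (j := i.succ) (by simp) (Fin.succ_ne_zero _).symm

lemma curryLeft_eq_zero_iff {m : ℕ} {A : V [⋀^Fin (m + 1)]→ₗ[k] N} {x : V} :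
    A.curryLeft x = 0 ↔ x ∈ A.radical := by
  rw [mem_radical_iff_cons]
  exact ⟨fun h w => DFunLike.congr_fun h w, fun h => ext h⟩

lemma apply_cons_cons_swap {m : ℕ} (A : V [⋀^Fin (m + 2)]→ₗ[k] N) (x y : V) (w : Fin m → V) :
    A (Matrix.vecCons x (Matrix.vecCons y w)) = -A (Matrix.vecCons y (Matrix.vecCons x w)) := by
  rw [← A.map_swap (v := Matrix.vecCons y (Matrix.vecCons x w)) (i := 0) (j := 1) (by simp)]
  congr 1
  ext i
  refine Fin.cases ?_ (fun i => Fin.cases ?_ (fun i => ?_) i) i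
  · simp
  · simp
  · rw [Function.comp_apply, Equiv.swap_apply_of_ne_of_ne]
    · simp
    · exact Fin.succ_ne_zero _
    · exact fun h => Fin.succ_ne_zero _ (Fin.succ_injective _ h)

lemma mem_radical_curryLeft_comm {m : ℕ} {A : V [⋀^Fin (m + 2)]→ₗ[k] N} {x y : V} :
    x ∈ (A.curryLeft y).radical ↔ y ∈ (A.curryLeft x).radical := by
  simp only [mem_radical_iff_cons, curryLeft_apply_apply]
  simp only [A.apply_cons_cons_swap x y, neg_eq_zero]

/-! ### Plücker relations and decomposable forms -/

section Plucker

variable {m : ℕ} (θ : V [⋀^Fin (m + 1)]→ₗ[k] k) (e : Fin (m + 1) → V)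

/-- The linear forms `v ↦ θ (e₀, …, v, …, eₘ)`, where `v` takes the place of one of the vectors of
the frame `e`. If `θ` is decomposable and `θ e = 1`, it is the product of these forms. -/
def frameForms : V →ₗ[k] (Fin (m + 1) → k) :=
  LinearMap.pi fun i => θ.toMultilinearMap.toLinearMap e i

@[simp]
lemma frameForms_apply (v : V) (i : Fin (m + 1)) :
    θ.frameForms e v i = θ (Function.update e i v) := rfl

variable {θ e}

lemma frameForms_frame (he : θ e = 1) (j : Fin (m + 1)) :
    θ.frameForms e (e j) = Pi.single j 1 := by
  ext i
  rw [frameForms_apply]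
  by_cases h : i = j
  · subst h
    simp [he]
  · rw [Pi.single_eq_of_ne h]
    exact θ.map_update_self _ h

lemma frameForms_surjective (he : θ e = 1) : Function.Surjective (θ.frameForms e) := by
  intro c
  refine ⟨∑ j, c j • e j, ?_⟩
  ext i
  simp [map_sum, frameForms_frame he, Pi.single_apply, -frameForms_apply]

lemma radical_le_ker_frameForms : θ.radical ≤ LinearMap.ker (θ.frameForms e) := by
  intro v hv
  rw [LinearMap.mem_ker]
  ext i
  exact mem_radical.1 hv _ _

/-- A form vanishes on tuples that consist of a vector killed by the frame forms and of vectors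
of the frame. -/
lemma apply_eq_zero_of_mem_ker_frameForms {v : V} (hv : v ∈ LinearMap.ker (θ.frameForms e))
    {u : Fin (m + 1) → V} {i : Fin (m + 1)} (hi : u i = v) (hu : ∀ j ≠ i, u j ∈ Set.range e) :
    θ u = 0 := by
  choose! f hf using hu
  -- the vectors of the frame that occur in `u` all differ from some `e j`
  obtain ⟨j, hj⟩ : ∃ j, j ∉ (Finset.univ.erase i).image f := by
    by_contra! h
    have h1 := Finset.card_le_card (fun j _ => h j : Finset.univ ⊆ (Finset.univ.erase i).image f)
    have h2 := (Finset.card_image_le (s := Finset.univ.erase i) (f := f))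
    simp [Finset.card_erase_of_mem] at h1 h2
    omega
  have hu : u = Function.update e j v ∘ Function.update f i j := by
    ext l
    rw [Function.comp_apply]
    by_cases hl : l = i
    · subst hl
      simp [hi]
    · rw [Function.update_of_ne hl, Function.update_of_ne, hf l hl]
      rintro rfl
      exact hj (Finset.mem_image_of_mem _ (by simpa using hl))
  by_cases hinj : Function.Injective (Function.update f i j)
  · have := θ.map_perm (Function.update e j v)
      (Equiv.ofBijective _ (Finite.injective_iff_bijective.1 hinj))
    rw [hu]
    refine this.trans ?_
    rw [← frameForms_apply, LinearMap.mem_ker.1 hv]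
    simp
  · rw [hu]
    refine θ.map_eq_zero_of_not_injective _ fun h => hinj h.of_comp

/-- Plücker's relations for a form imply that it is decomposable. -/
lemma ker_frameForms_le_radical_of_plucker (he : θ e = 1)
    (h : ∀ (w : Fin m → V) (u : Fin (m + 2) → V), ∑ j : Fin (m + 2), (-1) ^ (j : ℕ) *
      (θ (Matrix.vecCons (u j) w) * θ (j.removeNth u)) = 0) :
    LinearMap.ker (θ.frameForms e) ≤ θ.radical := by
  intro v hv
  rw [mem_radical_iff_cons]
  intro w
  have h1 := h w (Matrix.vecCons v e)
  rw [Fin.sum_univ_succ, Finset.sum_eq_zero] at h1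
  · have h2 : Fin.removeNth 0 (Matrix.vecCons v e) = e := by ext j; simp [Fin.removeNth]
    simpa [h2, he] using h1
  · intro j _
    have h0 : θ (j.succ.removeNth (Matrix.vecCons v e)) = 0 := by
      refine apply_eq_zero_of_mem_ker_frameForms hv (i := 0) (by simp [Fin.removeNth]) ?_
      intro l hl
      obtain ⟨l, rfl⟩ := Fin.exists_succ_eq.2 hl
      simp [Fin.removeNth]
    rw [h0, mul_zero, mul_zero]

end Plucker

/-- A form of degree at least three is decomposable if all its contractions with vectors satisfy
Plücker's relations. -/
lemma ker_frameForms_le_radical_of_plucker_curryLeft {m : ℕ} {θ : V [⋀^Fin (m + 3)]→ₗ[k] k}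
    {e : Fin (m + 3) → V} (he : θ e = 1)
    (h : ∀ (x : V) (w : Fin (m + 1) → V) (u : Fin (m + 3) → V),
      ∑ j : Fin (m + 3), (-1) ^ (j : ℕ) *
        (θ (Matrix.vecCons x (Matrix.vecCons (u j) w)) *
          θ (Matrix.vecCons x (j.removeNth u))) = 0) :
    LinearMap.ker (θ.frameForms e) ≤ θ.radical := by
  -- contracting with a vector of the frame
  have step1 : ∀ v ∈ LinearMap.ker (θ.frameForms e), ∀ i, e i ∈ (θ.curryLeft v).radical := by
    intro v hv i
    rw [mem_radical_curryLeft_comm, mem_radical_iff_cons]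
    intro w
    have h1 := h (e i) w (Function.update e i v)
    rw [Finset.sum_eq_single i] at h1
    · have h2 : θ (Matrix.vecCons (e i) (i.removeNth e)) ≠ 0 := by
        rw [← neg_one_pow_smul_map_insertNth (p := i), Fin.insertNth_self_removeNth, he]
        simp
      simpa [h2] using h1
    · intro j _ hj
      obtain ⟨l, rfl⟩ := Fin.exists_succAbove_eq hj.symm
      have h0 : θ (Matrix.vecCons (e (j.succAbove l))
          (j.removeNth (Function.update e (j.succAbove l) v))) = 0 := by
        refine apply_eq_zero_of_mem_ker_frameForms hv (i := l.succ) (by simp) ?_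
        intro a ha
        refine Fin.cases (fun _ => by simp) (fun a ha => ?_) a ha
        have : a ≠ l := fun h => ha (by rw [h])
        simp [this, Fin.removeNth]
      rw [h0, mul_zero, mul_zero]
    · simp
  -- contracting with the sum of a vector of the frame and of a vector killed by the frame forms
  have step2 : ∀ v ∈ LinearMap.ker (θ.frameForms e), ∀ z ∈ LinearMap.ker (θ.frameForms e),
      z ∈ (θ.curryLeft v).radical := by
    intro v hv z hz
    have h0 : Matrix.vecCons (e 0) (Fin.tail e) = e := Fin.cons_self_tail e
    rw [mem_radical_curryLeft_comm, mem_radical_iff_cons]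
    intro w
    have h1 := h (e 0 + z) w (Matrix.vecCons v (Fin.tail e))
    have h2 : ∀ w, θ (Matrix.vecCons (e 0) (Matrix.vecCons v w)) = 0 := fun w =>
      mem_radical_iff_cons.1 (mem_radical_curryLeft_comm.1 (step1 v hv 0)) w
    have h3 : θ (Matrix.vecCons z (Fin.tail e)) = 0 := by
      have h7 : Function.update e 0 z = Matrix.vecCons z (Fin.tail e) := by
        conv_lhs => rw [← h0]
        exact Fin.update_cons_zero _ _ _
      have := congrFun (LinearMap.mem_ker.1 hz) 0
      rwa [frameForms_apply, h7] at this
    have h4 : ∀ j : Fin (m + 2), θ (Matrix.vecCons z (Matrix.vecCons v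
        (j.removeNth (Fin.tail e)))) = 0 := by
      intro j
      rw [apply_cons_cons_swap, neg_eq_zero]
      exact apply_eq_zero_of_mem_radical (A := θ.curryLeft v)
        (u := Matrix.vecCons z (j.removeNth (Fin.tail e))) (Fin.succ 0) (step1 v hv _)
    have h5 : ∀ j : Fin (m + 2), j.succ.removeNth (Matrix.vecCons v (Fin.tail e)) =
        Matrix.vecCons v (j.removeNth (Fin.tail e)) := by
      intro j
      ext l : 1
      refine Fin.cases ?_ (fun l => ?_) l <;> simp [Fin.removeNth]
    have h6 : Fin.removeNth 0 (Matrix.vecCons v (Fin.tail e)) = Fin.tail e := by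
      ext j : 1
      simp [Fin.removeNth]
    rw [Fin.sum_univ_succ] at h1
    simpa [map_vecCons_add, h2, h3, h4, h5, h6, h0, he] using h1
  intro v hv
  rw [← curryLeft_eq_zero_iff]
  have htop : ∀ z, z ∈ (θ.curryLeft v).radical := by
    intro z
    rw [← sub_add_cancel z (∑ j, θ.frameForms e z j • e j)]
    refine add_mem (step2 v hv _ ?_) (sum_mem fun j _ => Submodule.smul_mem _ _ (step1 v hv j))
    rw [LinearMap.mem_ker, map_sub, sub_eq_zero]
    ext i
    simp [map_sum, frameForms_frame he, Pi.single_apply, -frameForms_apply]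
  ext u
  exact apply_eq_zero_of_mem_radical 0 (htop _)

end AlternatingMap

namespace AlternatingMap

variable {k V : Type*} [Field k] [AddCommGroup V] [Module k V]

lemma sum_apply {ι κ N : Type*} [AddCommGroup N] [Module k N] (s : Finset κ)
    (A : κ → V [⋀^ι]→ₗ[k] N) (v : ι → V) : (∑ j ∈ s, A j) v = ∑ j ∈ s, A j v := by
  classical
  induction s using Finset.induction with
  | empty => simp
  | insert j s hj ih => simp [Finset.sum_insert hj, ih]

omit [Field k] [AddCommGroup V] [Module k V] in
lemma update_vecCons_succ {m : ℕ} (x y : V) (v : Fin m → V) (i : Fin m) :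
    Function.update (Matrix.vecCons x v) i.succ y = Matrix.vecCons x (Function.update v i y) :=
  (Fin.cons_update (α := fun _ => V) x v i y).symm

lemma exists_apply_eq_one {m : ℕ} {θ : V [⋀^Fin (m + 1)]→ₗ[k] k} (hθ : θ ≠ 0) :
    ∃ e, θ e = 1 := by
  obtain ⟨e, he⟩ : ∃ e, θ e ≠ 0 := by
    by_contra! h
    exact hθ (ext h)
  refine ⟨Function.update e 0 ((θ e)⁻¹ • e 0), ?_⟩
  rw [θ.map_update_smul, Function.update_eq_self, smul_eq_mul, inv_mul_cancel₀ he]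

lemma ker_frameForms_eq_radical [FiniteDimensional k V] {m : ℕ} {θ : V [⋀^Fin (m + 1)]→ₗ[k] k}
    {e : Fin (m + 1) → V} (he : θ e = 1) (h : Module.finrank k (V ⧸ θ.radical) = m + 1) :
    LinearMap.ker (θ.frameForms e) = θ.radical := by
  refine (Submodule.eq_of_le_of_finrank_le radical_le_ker_frameForms ?_).symm
  have h1 := ((θ.frameForms e).quotKerEquivOfSurjective (frameForms_surjective he)).finrank_eq
  have h2 := (LinearMap.ker (θ.frameForms e)).finrank_quotient_add_finrank
  have h3 := θ.radical.finrank_quotient_add_finrank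
  simp only [Module.finrank_fin_fun] at h1
  omega

lemma finrank_quotient_radical_of_ker_frameForms_le {m : ℕ} {θ : V [⋀^Fin (m + 1)]→ₗ[k] k}
    {e : Fin (m + 1) → V} (he : θ e = 1) (h : LinearMap.ker (θ.frameForms e) ≤ θ.radical) :
    Module.finrank k (V ⧸ θ.radical) = m + 1 := by
  rw [← le_antisymm h radical_le_ker_frameForms,
    ((θ.frameForms e).quotKerEquivOfSurjective (frameForms_surjective he)).finrank_eq,
    Module.finrank_fin_fun]

/-- The exterior product of a linear form and of an alternating form vanishes if both are pulled
back from a space whose dimension is less than the degree of the product. -/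
lemma sum_mul_removeNth_eq_zero [FiniteDimensional k V] {m : ℕ} (α : V →ₗ[k] k)
    (η : V [⋀^Fin m]→ₗ[k] k) {K : Submodule k V} (hα : K ≤ LinearMap.ker α) (hη : K ≤ η.radical)
    (h : Module.finrank k (V ⧸ K) < m + 1) (u : Fin (m + 1) → V) :
    ∑ j : Fin (m + 1), (-1) ^ (j : ℕ) * (α (u j) * η (j.removeNth u)) = 0 := by
  let A := alternatizeUncurryFin (α.smulRight η)
  have hA : ∀ u, A u = ∑ j : Fin (m + 1), (-1) ^ (j : ℕ) * (α (u j) * η (j.removeNth u)) := by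
    intro u
    simp [A, alternatizeUncurryFin_apply]
  rw [← hA, A.eq_zero_of_finrank_lt (K := K) _ (by simpa using h), zero_apply]
  intro v hv
  refine mem_radical.2 fun w i => ?_
  rw [hA]
  refine Finset.sum_eq_zero fun j _ => ?_
  by_cases hj : j = i
  · subst hj
    rw [Function.update_self, LinearMap.mem_ker.1 (hα hv), zero_mul, mul_zero]
  · obtain ⟨l, rfl⟩ := Fin.exists_succAbove_eq (Ne.symm hj)
    rw [apply_eq_zero_of_mem_radical l, mul_zero, mul_zero]
    simpa [Fin.removeNth] using hη hv

/-- A vector outside the radical of a form enlarges the radical when the form is contracted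
with it. -/
lemma radical_lt_radical_curryLeft {m : ℕ} {θ : V [⋀^Fin (m + 1)]→ₗ[k] k} {x : V}
    (hx : x ∉ θ.radical) : θ.radical < (θ.curryLeft x).radical :=
  lt_of_le_of_ne (radical_le_radical_curryLeft θ x)
    fun h => hx (h ▸ mem_radical_curryLeft_self θ x)

end AlternatingMap

namespace Submodule

variable {k V : Type*} [Field k] [AddCommGroup V] [Module k V] [FiniteDimensional k V]

lemma finrank_quotient_lt_of_lt {K L : Submodule k V} (h : K < L) :
    Module.finrank k (V ⧸ L) < Module.finrank k (V ⧸ K) := by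
  have h1 := Submodule.finrank_lt_finrank_of_lt h
  have h2 := K.finrank_quotient_add_finrank
  have h3 := L.finrank_quotient_add_finrank
  omega

lemma eq_of_le_of_finrank_quotient_le {K L : Submodule k V} (h : K ≤ L)
    (h' : Module.finrank k (V ⧸ K) ≤ Module.finrank k (V ⧸ L)) : K = L := by
  by_contra hne
  exact absurd (finrank_quotient_lt_of_lt (lt_of_le_of_ne h hne)) (not_lt.2 h')

end Submodule

/-! ### Projective forms of degree zero -/

namespace Foliation

open AlternatingMap

variable {k : Type*} [Field k] {n q : ℕ}

lemma contractExcept_apply (ω : Form k n q) (v : Fin q → Fin (n + 1) → k) (i : Fin q)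
    (u : Fin (n + 1) → k) : contractExcept ω v i u = ω (Function.update v i u) := rfl

lemma wedgeOne_apply {r : ℕ} (α : (Fin (n + 1) → k) →ₗ[k] MvPolynomial (Fin (n + 1)) k)
    (η : Form k n r) (u : Fin (r + 1) → Fin (n + 1) → k) :
    wedgeOne α η u = ∑ j : Fin (r + 1), (-1) ^ (j : ℕ) * (α (u j) * η (j.removeNth u)) := by
  simp [wedgeOne, alternatizeUncurryFin_apply]

lemma extD_apply (ω : Form k n q) (u : Fin (q + 1) → Fin (n + 1) → k) :
    extD ω u = ∑ j : Fin (q + 1), (-1) ^ (j : ℕ) * dirDeriv (u j) (ω (j.removeNth u)) := by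
  simp [extD, alternatizeUncurryFin_apply]

lemma dirDeriv_apply (v : Fin (n + 1) → k) (p : MvPolynomial (Fin (n + 1)) k) :
    dirDeriv v p = ∑ j, v j • MvPolynomial.pderiv j p := by
  simp [dirDeriv, LinearMap.sum_apply]

/-- The contraction of the constant form `θ` with the radial vector field. -/
noncomputable def radialContraction (θ : (Fin (n + 1) → k) [⋀^Fin (q + 1)]→ₗ[k] k) : Form k n q :=
  ∑ j, (LinearMap.toSpanSingleton k (MvPolynomial (Fin (n + 1)) k)
    (MvPolynomial.X j)).compAlternatingMap (θ.curryLeft (Pi.single j 1))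

lemma radialContraction_apply (θ : (Fin (n + 1) → k) [⋀^Fin (q + 1)]→ₗ[k] k)
    (v : Fin q → Fin (n + 1) → k) : radialContraction θ v =
      ∑ j, θ (Matrix.vecCons (Pi.single j 1) v) • MvPolynomial.X j := by
  simp [radialContraction, AlternatingMap.sum_apply]

lemma sum_mul_apply_single {m : ℕ} (l : (Fin m → k) →ₗ[k] k) (x : Fin m → k) :
    ∑ j, x j * l (Pi.single j 1) = l x := by
  conv_rhs => rw [← (Pi.basisFun k (Fin m)).sum_repr x]
  simp

lemma sum_apply_cons_single (θ : (Fin (n + 1) → k) [⋀^Fin (q + 1)]→ₗ[k] k)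
    (x : Fin (n + 1) → k) (v : Fin q → Fin (n + 1) → k) :
    ∑ j, x j * θ (Matrix.vecCons (Pi.single j 1) v) = θ (Matrix.vecCons x v) := by
  have h := sum_mul_apply_single (θ.toMultilinearMap.toLinearMap (Matrix.vecCons 0 v) 0) x
  simpa [Matrix.vecCons] using h

@[simp]
lemma eval_radialContraction (θ : (Fin (n + 1) → k) [⋀^Fin (q + 1)]→ₗ[k] k)
    (x : Fin (n + 1) → k) (v : Fin q → Fin (n + 1) → k) :
    MvPolynomial.eval x (radialContraction θ v) = θ (Matrix.vecCons x v) := by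
  simp [radialContraction_apply, map_sum, MvPolynomial.smul_eval, mul_comm _ (x _),
    sum_apply_cons_single]

lemma dirDeriv_radialContraction (θ : (Fin (n + 1) → k) [⋀^Fin (q + 1)]→ₗ[k] k)
    (x : Fin (n + 1) → k) (v : Fin q → Fin (n + 1) → k) :
    dirDeriv x (radialContraction θ v) = MvPolynomial.C (θ (Matrix.vecCons x v)) := by
  simp only [dirDeriv_apply, radialContraction_apply, map_sum, Derivation.map_smul,
    MvPolynomial.pderiv_X, ← sum_apply_cons_single θ x v]
  refine Finset.sum_congr rfl fun j _ => ?_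
  rw [Finset.sum_eq_single j]
  · simp [MvPolynomial.smul_eq_C_mul, mul_comm]
  · intro l _ hl
    simp [hl]
  · simp

lemma sum_X_mul_radialContraction [Infinite k] (θ : (Fin (n + 1) → k) [⋀^Fin (q + 1)]→ₗ[k] k)
    (v : Fin q → Fin (n + 1) → k) (i : Fin q) :
    ∑ j, MvPolynomial.X j * contractExcept (radialContraction θ) v i (Pi.single j 1) = 0 := by
  refine MvPolynomial.funext fun x => ?_
  have h := sum_mul_apply_single
    (θ.toMultilinearMap.toLinearMap (Matrix.vecCons x v) i.succ) x
  simp only [MultilinearMap.toLinearMap_apply, coe_multilinearMap, update_vecCons_succ] at h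
  rw [θ.map_eq_zero_of_eq (Matrix.vecCons x _) (i := 0) (j := i.succ) (by simp)
    (Fin.succ_ne_zero _).symm] at h
  simpa [contractExcept_apply, map_sum] using h

lemma eval_eq_sum_of_isHomogeneous_one {p : MvPolynomial (Fin (n + 1)) k} (hp : p.IsHomogeneous 1)
    (x : Fin (n + 1) → k) :
    MvPolynomial.eval x p = ∑ j, x j * MvPolynomial.coeff (Finsupp.single j 1) p := by
  rw [← MvPolynomial.mem_homogeneousSubmodule,
    MvPolynomial.homogeneousSubmodule_one_eq_span_X] at hp
  induction hp using Submodule.span_induction with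
  | mem p hp =>
    obtain ⟨i, rfl⟩ := hp
    simp [MvPolynomial.coeff_X, Finsupp.single_left_inj]
  | zero => simp
  | add p p' _ _ h h' => simp [h, h', mul_add, Finset.sum_add_distrib]
  | smul c p _ h => simp [MvPolynomial.smul_eval, h, Finset.mul_sum, mul_left_comm]

lemma eval_contractExcept_self {d : ℕ} {ω : Form k n q} (hω : ω ∈ projForms k n q d)
    (x : Fin (n + 1) → k) (v : Fin q → Fin (n + 1) → k) (i : Fin q) :
    MvPolynomial.eval x (ω (Function.update v i x)) = 0 := by
  have h := congrArg (MvPolynomial.eval x) (hω.2 v i)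
  have h' := sum_mul_apply_single
    ((MvPolynomial.aeval x).toLinearMap ∘ₗ contractExcept ω v i) x
  simp only [map_sum, map_mul, MvPolynomial.eval_X, _root_.map_zero] at h
  simpa [contractExcept_apply] using h'.symm.trans h

/-- The constant form `θ` with `θ(x, v) = ω_x(v)`, for a projective form `ω` of degree zero. -/
noncomputable def toConstantForm (ω : projForms k n q 0) :
    (Fin (n + 1) → k) [⋀^Fin (q + 1)]→ₗ[k] k where
  toMultilinearMap := LinearMap.uncurryLeft (R := k) (M := fun _ => Fin (n + 1) → k) (∑ j,
    (LinearMap.proj j : (Fin (n + 1) → k) →ₗ[k] k).smulRight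
      ((MvPolynomial.lcoeff k (Finsupp.single j 1)).compAlternatingMap
        (ω : Form k n q)).toMultilinearMap)
  map_eq_zero_of_eq' := by
    have key : ∀ w : Fin (q + 1) → Fin (n + 1) → k,
        (LinearMap.uncurryLeft (R := k) (M := fun _ => Fin (n + 1) → k) (∑ j,
        (LinearMap.proj j : (Fin (n + 1) → k) →ₗ[k] k).smulRight
        ((MvPolynomial.lcoeff k (Finsupp.single j 1)).compAlternatingMap
          (ω : Form k n q)).toMultilinearMap)) w =
        MvPolynomial.eval (w 0) ((ω : Form k n q) (Fin.tail w)) := by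
      intro w
      rw [eval_eq_sum_of_isHomogeneous_one (ω.2.1 _)]
      simp [LinearMap.uncurryLeft_apply, LinearMap.sum_apply]
    have key' : ∀ (w : Fin (q + 1) → Fin (n + 1) → k) (i : Fin q), w 0 = w i.succ →
        MvPolynomial.eval (w 0) ((ω : Form k n q) (Fin.tail w)) = 0 := by
      intro w i h
      have := eval_contractExcept_self ω.2 (w 0) (Fin.tail w) i
      rw [h, show w i.succ = Fin.tail w i from rfl, Function.update_eq_self] at this
      rwa [h]
    intro w i j hij hne
    change LinearMap.uncurryLeft _ w = 0
    rw [key]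
    obtain rfl | ⟨i, rfl⟩ := i.eq_zero_or_eq_succ
    · obtain rfl | ⟨j, rfl⟩ := j.eq_zero_or_eq_succ
      · exact absurd rfl hne
      · exact key' w j hij
    · obtain rfl | ⟨j, rfl⟩ := j.eq_zero_or_eq_succ
      · exact key' w i hij.symm
      · rw [(ω : Form k n q).map_eq_zero_of_eq (Fin.tail w) (i := i) (j := j) hij
          (fun h => hne (by rw [h])), _root_.map_zero]

lemma toConstantForm_apply (ω : projForms k n q 0) (w : Fin (q + 1) → Fin (n + 1) → k) :
    toConstantForm ω w = MvPolynomial.eval (w 0) ((ω : Form k n q) (Fin.tail w)) := by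
  rw [eval_eq_sum_of_isHomogeneous_one (ω.2.1 _)]
  change LinearMap.uncurryLeft _ w = _
  simp [LinearMap.uncurryLeft_apply, LinearMap.sum_apply]

variable (k n q) in
/-- Every projective `q`-form of degree zero is the contraction with the radial vector field of a
unique constant `(q + 1)`-form. -/
noncomputable def constantFormEquiv [Infinite k] :
    ((Fin (n + 1) → k) [⋀^Fin (q + 1)]→ₗ[k] k) ≃ₗ[k] projForms k n q 0 where
  toFun θ := ⟨radialContraction θ, fun v => by
    rw [radialContraction_apply]
    refine MvPolynomial.IsHomogeneous.sum _ _ _ fun j _ => ?_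
    rw [MvPolynomial.smul_eq_C_mul]
    exact (MvPolynomial.isHomogeneous_X k j).C_mul _, sum_X_mul_radialContraction θ⟩
  map_add' θ θ' := by
    ext v : 2
    refine MvPolynomial.funext fun x => ?_
    simp
  map_smul' c θ := by
    ext v : 2
    refine MvPolynomial.funext fun x => ?_
    simp [MvPolynomial.smul_eval]
  invFun := toConstantForm
  left_inv θ := by
    ext w
    rw [toConstantForm_apply]
    simp only [eval_radialContraction]
    exact congrArg θ (Fin.cons_self_tail w)
  right_inv ω := by
    ext v : 2
    refine MvPolynomial.funext fun x => ?_
    simp only [eval_radialContraction, toConstantForm_apply]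
    rfl

lemma coe_constantFormEquiv [Infinite k] (θ : (Fin (n + 1) → k) [⋀^Fin (q + 1)]→ₗ[k] k) :
    (constantFormEquiv k n q θ : Form k n q) = radialContraction θ := rfl

lemma extD_radialContraction (θ : (Fin (n + 1) → k) [⋀^Fin (q + 1)]→ₗ[k] k)
    (u : Fin (q + 1) → Fin (n + 1) → k) :
    extD (radialContraction θ) u = MvPolynomial.C ((q + 1 : k) * θ u) := by
  simp only [extD_apply, dirDeriv_radialContraction]
  have : ∀ j : Fin (q + 1), (-1) ^ (j : ℕ) * MvPolynomial.C (θ (Matrix.vecCons (u j) (j.removeNth u)))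
      = (MvPolynomial.C (θ u) : MvPolynomial (Fin (n + 1)) k) := by
    intro j
    rw [← neg_one_pow_smul_map_insertNth (p := j), Fin.insertNth_self_removeNth, zsmul_eq_mul,
      map_mul,
      ← mul_assoc]
    simp [← mul_pow]
  simp [this]

/-! ### Foliations of degree zero -/

variable [Infinite k] {θ : (Fin (n + 1) → k) [⋀^Fin (q + 1)]→ₗ[k] k}

lemma isLocallyDecomposable_radialContraction_iff :
    IsLocallyDecomposable (radialContraction θ) ↔ ∀ (x : Fin (n + 1) → k) (v) (i : Fin q) (u),
      ∑ j : Fin (q + 1), (-1) ^ (j : ℕ) * (θ (Matrix.vecCons x (Function.update v i (u j))) *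
        θ (Matrix.vecCons x (j.removeNth u))) = 0 := by
  have key : ∀ (x : Fin (n + 1) → k) (v) (i : Fin q) (u), MvPolynomial.eval x
      (wedgeOne (contractExcept (radialContraction θ) v i) (radialContraction θ) u) =
      ∑ j : Fin (q + 1), (-1) ^ (j : ℕ) * (θ (Matrix.vecCons x (Function.update v i (u j))) *
        θ (Matrix.vecCons x (j.removeNth u))) := by
    intro x v i u
    simp [wedgeOne_apply, contractExcept_apply, map_sum]
  refine ⟨fun h x v i u => ?_, fun h v i => ?_⟩
  · rw [← key, h v i]
    simp
  · ext u : 1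
    exact MvPolynomial.funext fun x => by rw [key, h]; simp

lemma satisfiesIntegrability_radialContraction_iff :
    SatisfiesIntegrability (radialContraction θ) ↔ ∀ (x : Fin (n + 1) → k) (v) (i : Fin q) (u),
      ∑ j : Fin (q + 2), (-1) ^ (j : ℕ) * (θ (Matrix.vecCons x (Function.update v i (u j))) *
        ((q + 1 : k) * θ (j.removeNth u))) = 0 := by
  have key : ∀ (x : Fin (n + 1) → k) (v) (i : Fin q) (u), MvPolynomial.eval x
      (wedgeOne (contractExcept (radialContraction θ) v i) (extD (radialContraction θ)) u) =
      ∑ j : Fin (q + 2), (-1) ^ (j : ℕ) * (θ (Matrix.vecCons x (Function.update v i (u j))) *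
        ((q + 1 : k) * θ (j.removeNth u))) := by
    intro x v i u
    simp [wedgeOne_apply, contractExcept_apply, map_sum, extD_radialContraction]
  refine ⟨fun h x v i u => ?_, fun h v i => ?_⟩
  · rw [← key, h v i]
    simp
  · ext u : 1
    exact MvPolynomial.funext fun x => by rw [key, h]; simp

lemma isLocallyDecomposable_of_finrank
    (h : Module.finrank k ((Fin (n + 1) → k) ⧸ θ.radical) ≤ q + 1) :
    IsLocallyDecomposable (radialContraction θ) := by
  rw [isLocallyDecomposable_radialContraction_iff]
  intro x v i u
  by_cases hx : x ∈ θ.radical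
  · refine Finset.sum_eq_zero fun j _ => ?_
    rw [mem_radical_iff_cons.1 hx, zero_mul, mul_zero]
  · refine sum_mul_removeNth_eq_zero (K := (θ.curryLeft x).radical)
      ((θ.curryLeft x).toMultilinearMap.toLinearMap v i) (θ.curryLeft x) ?_ le_rfl ?_ u
    · exact fun y hy => mem_radical.1 hy v i
    · exact (Submodule.finrank_quotient_lt_of_lt (radical_lt_radical_curryLeft hx)).trans_le h

lemma satisfiesIntegrability_of_finrank
    (h : Module.finrank k ((Fin (n + 1) → k) ⧸ θ.radical) ≤ q + 1) :
    SatisfiesIntegrability (radialContraction θ) := by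
  rw [satisfiesIntegrability_radialContraction_iff]
  intro x v i u
  have := sum_mul_removeNth_eq_zero (K := θ.radical)
      ((θ.curryLeft x).toMultilinearMap.toLinearMap v i) ((q + 1 : k) • θ) ?_ ?_
      (by omega) u
  · simpa [update_vecCons_succ, Matrix.vecCons] using this
  · exact fun y hy => mem_radical.1 (radical_le_radical_curryLeft θ x hy) v i
  · exact fun y hy => mem_radical.2 fun w i => by simp [mem_radical.1 hy w i]

lemma finrank_quotient_radical_eq (hθ : θ ≠ 0) (hq : 1 ≤ q) (h : ringChar k ≠ 2 ∨ 1 < q)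
    (hdec : IsLocallyDecomposable (radialContraction θ))
    (hint : SatisfiesIntegrability (radialContraction θ)) :
    Module.finrank k ((Fin (n + 1) → k) ⧸ θ.radical) = q + 1 := by
  obtain ⟨e, he⟩ := exists_apply_eq_one hθ
  refine finrank_quotient_radical_of_ker_frameForms_le he ?_
  rw [isLocallyDecomposable_radialContraction_iff] at hdec
  rw [satisfiesIntegrability_radialContraction_iff] at hint
  by_cases hq1 : (q + 1 : k) = 0
  · have hq2 : 1 < q := by
      by_contra hq'
      obtain rfl : q = 1 := by omega
      refine (h.resolve_right hq') ?_
      have h2 : ((2 : ℕ) : k) = 0 := by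
        rw [← hq1]
        norm_num
      have h3 := (Nat.dvd_prime Nat.prime_two).1 (ringChar.dvd h2)
      exact h3.resolve_left (CharP.ringChar_ne_one)
    obtain ⟨m, rfl⟩ : ∃ m, q = m + 2 := ⟨q - 2, by omega⟩
    refine ker_frameForms_le_radical_of_plucker_curryLeft he fun x w u => ?_
    simpa [Matrix.vecCons, Fin.update_cons_zero] using hdec x (Matrix.vecCons 0 w) 0 u
  · obtain ⟨m, rfl⟩ : ∃ m, q = m + 1 := ⟨q - 1, by omega⟩
    refine ker_frameForms_le_radical_of_plucker he fun w u => ?_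
    have h1 := hint (w 0) (Matrix.vecCons 0 (Fin.tail w)) 0 u
    have h2 : ∀ j, θ (Matrix.vecCons (w 0) (Function.update
        (Matrix.vecCons 0 (Fin.tail w)) 0 (u j))) = -θ (Matrix.vecCons (u j) w) := by
      intro j
      have h3 : Matrix.vecCons (w 0) (Fin.tail w) = w := Fin.cons_self_tail w
      have h4 : Function.update (Matrix.vecCons 0 (Fin.tail w)) 0 (u j) =
        Matrix.vecCons (u j) (Fin.tail w) := Fin.update_cons_zero _ _ _
      rw [h4, apply_cons_cons_swap, h3]
    simp only [h2] at h1
    rw [← neg_eq_zero, ← mul_right_inj' hq1, mul_zero, ← h1, ← Finset.sum_neg_distrib,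
      Finset.mul_sum]
    refine Finset.sum_congr rfl fun j _ => ?_
    ring

omit [Infinite k] in
lemma kernelAt_radialContraction (x : Fin (n + 1) → k) :
    kernelAt (radialContraction θ) x = (θ.curryLeft x).radical := by
  ext v
  simp [kernelAt, Submodule.mem_iInf, mem_radical, contractExcept_apply,
    MvPolynomial.aeval_eq_eval]

omit [Infinite k] in
/-- A degree zero form is defined by a linear projection if and only if the radical of the
associated constant form is the kernel of the projection. -/
lemma isDefinedByProjection_radialContraction_iff (hθ : θ ≠ 0) (hq : 1 ≤ q)
    {π : (Fin (n + 1) → k) →ₗ[k] (Fin (q + 1) → k)} (hπ : Function.Surjective π) :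
    IsDefinedByProjection (radialContraction θ) π ↔ θ.radical = LinearMap.ker π := by
  have hker : Module.finrank k ((Fin (n + 1) → k) ⧸ LinearMap.ker π) = q + 1 := by
    rw [(π.quotKerEquivOfSurjective hπ).finrank_eq, Module.finrank_fin_fun]
  simp only [IsDefinedByProjection, kernelAt_radialContraction]
  constructor
  · intro h
    refine (Submodule.eq_of_le_of_finrank_quotient_le (fun v hv => ?_) ?_).symm
    · obtain ⟨m, rfl⟩ : ∃ m, q = m + 1 := ⟨q - 1, by omega⟩
      have h1 : ∀ x, π x ≠ 0 → x ∈ (θ.curryLeft v).radical := by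
        intro x hx
        rw [mem_radical_curryLeft_comm, h x hx, Submodule.mem_comap, LinearMap.mem_ker.1 hv]
        exact zero_mem _
      have h2 : ∀ x, x ∈ (θ.curryLeft v).radical := by
        intro x
        by_cases hx : π x = 0
        · obtain ⟨y, hy⟩ := hπ (Pi.single 0 1)
          have hy' : π y ≠ 0 := by simp [hy]
          rw [← add_sub_cancel_right x y]
          exact sub_mem (h1 _ (by simpa [hx] using hy')) (h1 _ hy')
        · exact h1 x hx
      rw [← curryLeft_eq_zero_iff]
      ext u
      exact apply_eq_zero_of_mem_radical 0 (h2 _)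
    · rw [hker]
      simpa using card_le_finrank_quotient_radical hθ
  · intro h x hx
    have hx' : x ∉ θ.radical := by rwa [h]
    refine (Submodule.eq_of_le_of_finrank_quotient_le (fun v hv => ?_) ?_).symm
    · obtain ⟨c, hc⟩ := Submodule.mem_span_singleton.1 (Submodule.mem_comap.1 hv)
      rw [← sub_add_cancel v (c • x)]
      refine add_mem (radical_le_radical_curryLeft θ x ?_)
        (Submodule.smul_mem _ _ (mem_radical_curryLeft_self θ x))
      rw [h, LinearMap.mem_ker, map_sub, map_smul, hc, sub_self]
    · have h1 : θ.curryLeft x ≠ 0 := fun h0 => hx' (curryLeft_eq_zero_iff.1 h0)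
      have h2 := card_le_finrank_quotient_radical h1
      have h3 : LinearMap.ker π < (Submodule.span k {π x}).comap π := by
        refine lt_of_le_of_ne (fun v hv => ?_) fun h4 => ?_
        · rw [Submodule.mem_comap, LinearMap.mem_ker.1 hv]
          exact zero_mem _
        · have : x ∈ (Submodule.span k {π x}).comap π := Submodule.mem_span_singleton_self _
          rw [← h4] at this
          exact hx this
      have h4 := Submodule.finrank_quotient_lt_of_lt h3
      simp only [Fintype.card_fin] at h2
      omega

end Foliation

/-! ### The Zariski topology of projective spaces -/

namespace ProjVar

open MvPolynomial

variable {k : Type*} [Field k] {W : Type*} [AddCommGroup W] [Module k W]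

lemma evalAt_smul {m : ℕ} {F : MvPolynomial (Module.Dual k W) k} (hF : F.IsHomogeneous m) (c : k)
    (w : W) : evalAt F (c • w) = c ^ m * evalAt F w := by
  simp only [evalAt, eval_eq, Finset.mul_sum]
  refine Finset.sum_congr rfl fun d hd => ?_
  have h := hF.degree_eq_sum_deg_support hd
  simp only [map_smul, smul_eq_mul, mul_pow, Finset.prod_mul_distrib, Finset.prod_pow_eq_pow_sum]
  rw [← h]
  ring

lemma exists_smul_rep (w : W) (hw : w ≠ 0) :
    ∃ c : k, c ≠ 0 ∧ (Projectivization.mk k w hw).rep = c • w := by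
  obtain ⟨a, ha⟩ := Projectivization.exists_smul_eq_mk_rep k w hw
  exact ⟨a, a.ne_zero, ha.symm⟩

lemma evalAt_rep_mk_eq_zero_iff {m : ℕ} {F : MvPolynomial (Module.Dual k W) k}
    (hF : F.IsHomogeneous m) {w : W} (hw : w ≠ 0) :
    evalAt F (Projectivization.mk k w hw).rep = 0 ↔ evalAt F w = 0 := by
  obtain ⟨c, hc, h⟩ := exists_smul_rep (k := k) w hw
  rw [h, evalAt_smul hF]
  simp [hc]

lemma rep_mk_mem_iff {U : Submodule k W} {w : W} (hw : w ≠ 0) :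
    (Projectivization.mk k w hw).rep ∈ U ↔ w ∈ U := by
  obtain ⟨c, hc, h⟩ := exists_smul_rep (k := k) w hw
  rw [h, U.smul_mem_iff hc]

lemma isTopologicalBasis : TopologicalSpace.IsTopologicalBasis
    {U : Set (ℙ k W) | ∃ (m : ℕ) (F : MvPolynomial (Module.Dual k W) k),
      F.IsHomogeneous m ∧ U = {p | evalAt F p.rep ≠ 0}} where
  exists_subset_inter := by
    rintro _ ⟨m, F, hF, rfl⟩ _ ⟨m', F', hF', rfl⟩ p hp
    refine ⟨_, ⟨m + m', F * F', hF.mul hF', rfl⟩, ?_, ?_⟩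
    · simpa [evalAt] using hp
    · intro p hp
      simpa [evalAt] using hp
  sUnion_eq := by
    refine Set.eq_univ_of_forall fun p => ?_
    exact ⟨_, ⟨0, 1, isHomogeneous_one _ _, rfl⟩, by simp [evalAt]⟩
  eq_generateFrom := rfl

lemma isOpen_evalAt_ne_zero {m : ℕ} {F : MvPolynomial (Module.Dual k W) k}
    (hF : F.IsHomogeneous m) : IsOpen {p : ℙ k W | evalAt F p.rep ≠ 0} :=
  isTopologicalBasis.isOpen ⟨m, F, hF, rfl⟩

lemma isClosed_evalAt_eq_zero {m : ℕ} {F : MvPolynomial (Module.Dual k W) k}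
    (hF : F.IsHomogeneous m) : IsClosed {p : ℙ k W | evalAt F p.rep = 0} := by
  rw [← isOpen_compl_iff]
  exact isOpen_evalAt_ne_zero hF

lemma isOpen_dual_ne_zero (l : Module.Dual k W) : IsOpen {p : ℙ k W | l p.rep ≠ 0} := by
  simpa [evalAt] using isOpen_evalAt_ne_zero (isHomogeneous_X k l)

/-- A linear subspace of a projective space is closed. -/
lemma isClosed_rep_mem (U : Submodule k W) : IsClosed {p : ℙ k W | p.rep ∈ U} := by
  have h : {p : ℙ k W | p.rep ∈ U} = ⋂ l ∈ U.dualAnnihilator, {p | evalAt (X l) p.rep = 0} := by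
    ext p
    have h1 := Subspace.forall_mem_dualAnnihilator_apply_eq_zero_iff U p.rep
    simpa [evalAt, Set.mem_iInter] using h1.symm
  rw [h]
  exact isClosed_biInter fun l _ => isClosed_evalAt_eq_zero (isHomogeneous_X k l)

/-! ### Polynomial parametrizations -/

/-- Maps from an affine space to a vector space that are polynomial in all linear coordinates. -/
def IsPolynomialMap {σ : Type*} (P : (σ → k) → W) : Prop :=
  ∀ l : Module.Dual k W, ∃ f : MvPolynomial σ k, ∀ a, l (P a) = eval a f

lemma IsPolynomialMap.exists_evalAt {σ : Type*} {P : (σ → k) → W} (hP : IsPolynomialMap P)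
    (F : MvPolynomial (Module.Dual k W) k) :
    ∃ f : MvPolynomial σ k, ∀ a, evalAt F (P a) = eval a f := by
  choose g hg using hP
  refine ⟨bind₁ g F, fun a => ?_⟩
  rw [evalAt, funext fun l => hg l a]
  exact (eval₂Hom_bind₁ (RingHom.id k) a g F).symm

lemma isPolynomialMap_add_sum_smul {σ : Type*} [Fintype σ] (w₀ : W) (w : σ → W) :
    IsPolynomialMap fun a : σ → k => w₀ + ∑ i, a i • w i := by
  intro l
  exact ⟨C (l w₀) + ∑ i, X i * C (l (w i)), fun a => by simp⟩

/-- In a finite-dimensional space it suffices to test the coordinates of a separating family. -/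
lemma isPolynomialMap_of_separating [FiniteDimensional k W] {σ : Type*} {P : (σ → k) → W}
    (S : Set (Module.Dual k W)) (hS : ∀ w, (∀ l ∈ S, l w = 0) → w = 0)
    (h : ∀ l ∈ S, ∃ f : MvPolynomial σ k, ∀ a, l (P a) = eval a f) : IsPolynomialMap P := by
  have htop : Submodule.span k S = ⊤ := by
    rw [← Subspace.dualCoannihilator_dualAnnihilator_eq (W := Submodule.span k S)]
    have : (Submodule.span k S).dualCoannihilator = ⊥ := by
      rw [eq_bot_iff]
      intro w hw
      rw [Submodule.mem_dualCoannihilator] at hw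
      exact hS w fun l hl => hw l (Submodule.subset_span hl)
    rw [this, Submodule.dualAnnihilator_bot]
  intro l
  have hl : l ∈ Submodule.span k S := htop ▸ Submodule.mem_top
  induction hl using Submodule.span_induction with
  | mem l hl => exact h l hl
  | zero => exact ⟨0, by simp⟩
  | add l l' _ _ h h' =>
    obtain ⟨f, hf⟩ := h
    obtain ⟨f', hf'⟩ := h'
    exact ⟨f + f', by simp [hf, hf']⟩
  | smul c l _ h =>
    obtain ⟨f, hf⟩ := h
    exact ⟨C c * f, by simp [hf]⟩

/-- A subset of a projective space that is parametrized by a polynomial map is irreducible. -/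
lemma isIrreducible_of_isPolynomialMap [Infinite k] {σ : Type*} {P : (σ → k) → W}
    (hP : IsPolynomialMap P) {Y : Set (ℙ k W)} (hne : Y.Nonempty)
    (hY : ∀ y, y ∈ Y ↔ ∃ (a : σ → k) (h : P a ≠ 0), y = Projectivization.mk k (P a) h) :
    IsIrreducible Y := by
  refine ⟨hne, fun U₁ U₂ hU₁ hU₂ => ?_⟩
  rintro ⟨y₁, hy₁, hy₁'⟩ ⟨y₂, hy₂, hy₂'⟩
  obtain ⟨_, ⟨m₁, F₁, hF₁, rfl⟩, hm₁, hs₁⟩ := isTopologicalBasis.exists_subset_of_mem_open hy₁' hU₁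
  obtain ⟨_, ⟨m₂, F₂, hF₂, rfl⟩, hm₂, hs₂⟩ := isTopologicalBasis.exists_subset_of_mem_open hy₂' hU₂
  obtain ⟨a₁, h₁, rfl⟩ := (hY _).1 hy₁
  obtain ⟨a₂, h₂, rfl⟩ := (hY _).1 hy₂
  obtain ⟨f₁, hf₁⟩ := hP.exists_evalAt F₁
  obtain ⟨f₂, hf₂⟩ := hP.exists_evalAt F₂
  -- a linear coordinate that ensures that the parametrization is defined at the common point
  obtain ⟨l, hl⟩ : ∃ l : Module.Dual k W, l (P a₁) ≠ 0 := by
    by_contra! h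
    exact h₁ ((Module.forall_dual_apply_eq_zero_iff k _).1 h)
  obtain ⟨g, hg⟩ := hP l
  have hm₁' : eval a₁ f₁ ≠ 0 := by
    rw [← hf₁]
    exact fun h => hm₁ ((evalAt_rep_mk_eq_zero_iff hF₁ h₁).2 h)
  have hm₂' : eval a₂ f₂ ≠ 0 := by
    rw [← hf₂]
    exact fun h => hm₂ ((evalAt_rep_mk_eq_zero_iff hF₂ h₂).2 h)
  have hprod : f₁ * f₂ * g ≠ 0 := by
    refine mul_ne_zero (mul_ne_zero ?_ ?_) ?_
    · rintro rfl
      simp at hm₁'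
    · rintro rfl
      simp at hm₂'
    · rintro rfl
      simp [hg] at hl
  obtain ⟨a, ha⟩ : ∃ a, eval a (f₁ * f₂ * g) ≠ 0 := by
    by_contra! h
    exact hprod (MvPolynomial.funext (by simpa using h))
  simp only [map_mul, mul_ne_zero_iff] at ha
  have hPa : P a ≠ 0 := by
    intro h
    apply ha.2
    rw [← hg, h, map_zero]
  refine ⟨Projectivization.mk k (P a) hPa, (hY _).2 ⟨a, hPa, rfl⟩, hs₁ ?_, hs₂ ?_⟩
  · refine fun h => ha.1.1 ?_
    rwa [evalAt_rep_mk_eq_zero_iff hF₁, hf₁] at h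
  · refine fun h => ha.1.2 ?_
    rwa [evalAt_rep_mk_eq_zero_iff hF₂, hf₂] at h

lemma isIrreducible_rep_mem [Infinite k] [FiniteDimensional k W] {U : Submodule k W}
    (hU : U ≠ ⊥) : IsIrreducible {p : ℙ k W | p.rep ∈ U} := by
  obtain ⟨u, hu, hu0⟩ := U.exists_mem_ne_zero_of_ne_bot hU
  let b := Module.finBasis k U
  refine isIrreducible_of_isPolynomialMap
    (isPolynomialMap_add_sum_smul (k := k) 0 fun i => (b i : W))
    ⟨Projectivization.mk k u hu0, (rep_mk_mem_iff hu0).2 hu⟩ fun y => ⟨fun hy => ?_, ?_⟩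
  · have h : 0 + ∑ i, b.repr ⟨y.rep, hy⟩ i • (b i : W) = y.rep := by
      rw [zero_add]
      simpa only [map_sum, map_smul, Submodule.subtype_apply] using
        congrArg U.subtype (b.sum_repr ⟨y.rep, hy⟩)
    refine ⟨fun i => b.repr ⟨y.rep, hy⟩ i, by rw [h]; exact y.rep_nonzero, ?_⟩
    simp only [h, Projectivization.mk_rep]
  · rintro ⟨a, ha, rfl⟩
    rw [Set.mem_ofPred_eq, rep_mk_mem_iff, zero_add]
    exact sum_mem fun i _ => U.smul_mem _ (b i).2

lemma isIrreducible_univ [Infinite k] [FiniteDimensional k W] [Nontrivial W] :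
    IsIrreducible (Set.univ : Set (ℙ k W)) := by
  simpa using isIrreducible_rep_mem (k := k) (W := W) (U := ⊤) top_ne_bot

/-- A linear subspace of codimension at least two has codimension at least two in the sense of
chains of irreducible closed sets. -/
lemma codimGeTwo_rep_mem [Infinite k] [FiniteDimensional k W] {U : Submodule k W}
    (hU : 2 ≤ Module.finrank k (W ⧸ U)) : CodimGeTwo {p : ℙ k W | p.rep ∈ U} := by
  intro Z hZ
  obtain ⟨z, hz⟩ := Z.isIrreducible.nonempty
  have hUbot : U ≠ ⊥ := by
    rintro rfl
    exact z.rep_nonzero (by simpa using hZ hz)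
  have h1 := U.finrank_quotient_add_finrank
  obtain ⟨v, hv⟩ : ∃ v, v ∉ U := by
    by_contra! h
    obtain rfl : U = ⊤ := Submodule.eq_top_iff'.2 h
    rw [finrank_top] at h1
    omega
  let H := U ⊔ Submodule.span k {v}
  have hvH : v ∈ H := Submodule.mem_sup_right (Submodule.mem_span_singleton_self v)
  obtain ⟨v', hv'⟩ : ∃ v', v' ∉ H := by
    by_contra! h
    have h2 : Module.finrank k H = Module.finrank k W := by
      rw [Submodule.eq_top_iff'.2 h, finrank_top]
    have h3 : Module.finrank k H ≤ _ :=
      Submodule.finrank_add_le_finrank_add_finrank U (Submodule.span k {v})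
    have h4 := finrank_span_singleton (K := k) (fun h0 => hv (h0 ▸ U.zero_mem) : v ≠ 0)
    omega
  have hHbot : H ≠ ⊥ := fun h => hUbot (eq_bot_iff.2 (h ▸ le_sup_left))
  have : Nontrivial W := ⟨v', 0, fun h => hv' (h ▸ H.zero_mem)⟩
  let ZU : TopologicalSpace.IrreducibleCloseds (ℙ k W) :=
    ⟨_, isIrreducible_rep_mem hUbot, isClosed_rep_mem U⟩
  let ZH : TopologicalSpace.IrreducibleCloseds (ℙ k W) :=
    ⟨_, isIrreducible_rep_mem hHbot, isClosed_rep_mem H⟩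
  let ZW : TopologicalSpace.IrreducibleCloseds (ℙ k W) :=
    ⟨Set.univ, isIrreducible_univ, isClosed_univ⟩
  have hUH : ZU < ZH := by
    refine lt_of_le_not_ge (fun p hp => (le_sup_left : U ≤ H) hp) fun h => hv ?_
    have hv0 : v ≠ 0 := fun h0 => hv (h0 ▸ U.zero_mem)
    exact (rep_mk_mem_iff hv0).1 (h ((rep_mk_mem_iff (U := H) hv0).2 hvH))
  have hHW : ZH < ZW := by
    refine lt_of_le_not_ge (fun p _ => Set.mem_univ p) fun h => hv' ?_
    have hv0 : v' ≠ 0 := fun h0 => hv' (h0 ▸ H.zero_mem)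
    exact (rep_mk_mem_iff hv0).1 (h (Set.mem_univ (Projectivization.mk k v' hv0)))
  have hZU : Z ≤ ZU := hZ
  calc (2 : ℕ∞) ≤ Order.coheight ZW + 1 + 1 := by
        rw [add_assoc, one_add_one_eq_two]; exact le_add_self
    _ ≤ Order.coheight ZH + 1 := by gcongr; exact Order.coheight_add_one_le hHW
    _ ≤ Order.coheight ZU := Order.coheight_add_one_le hUH
    _ ≤ Order.coheight Z := Order.coheight_anti hZU

/-! ### Linear isomorphisms -/

section Linear

variable {W' : Type*} [AddCommGroup W'] [Module k W'] {Y : Set (ℙ k W)} {Y' : Set (ℙ k W')}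

/-- Maps between subsets of projective spaces that are induced by a linear map are morphisms. -/
lemma isMorphism_of_linearMap (T : W →ₗ[k] W') (φ : Y → Y')
    (h : ∀ y : Y, ∃ c : k, c ≠ 0 ∧ (φ y).1.rep = c • T y.1.rep) : IsMorphism φ := by
  let pull : MvPolynomial (Module.Dual k W') k → MvPolynomial (Module.Dual k W) k :=
    rename fun l => l ∘ₗ T
  have hpull : ∀ F w, evalAt (pull F) w = evalAt F (T w) := by
    intro F w
    simp only [evalAt, pull, eval_rename]
    rfl
  have hhom : ∀ {m F}, IsHomogeneous F m → IsHomogeneous (pull F) m :=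
    fun hF => hF.rename_isHomogeneous
  have hrep : ∀ (y : Y), ∃ c : k, c ≠ 0 ∧ ∀ {m F}, IsHomogeneous F m →
      evalAt F (φ y).1.rep = c ^ m * evalAt (pull F) y.1.rep := by
    intro y
    obtain ⟨c, hc, hy⟩ := h y
    exact ⟨c, hc, fun hF => by rw [hy, evalAt_smul hF, hpull]⟩
  have hcont : Continuous φ := by
    refine Continuous.subtype_mk (f := fun y => (φ y).1) ?_ fun y => (φ y).2
    refine continuous_generateFrom_iff.2 ?_
    rintro _ ⟨m, F, hF, rfl⟩
    convert (isOpen_evalAt_ne_zero (hhom hF)).preimage (continuous_subtype_val (p := (· ∈ Y)))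
      using 1
    ext y
    obtain ⟨c, hc, hy⟩ := hrep y
    simp [hy hF, hc]
  refine ⟨hcont, fun U f _ hf y hy => ?_⟩
  obtain ⟨O, hO, hyO, m, F, G, hF, hG, hFG⟩ := hf (φ y) hy
  refine ⟨φ ⁻¹' O, hO.preimage hcont, hyO, m, pull F, pull G, hhom hF, hhom hG, fun z hz => ?_⟩
  obtain ⟨c, hc, hz'⟩ := hrep z
  obtain ⟨h1, h2⟩ := hFG (φ z) hz
  rw [hz' hG] at h1
  rw [Function.comp_apply, h2, hz' hG, hz' hF]
  exact ⟨right_ne_zero_of_mul h1, mul_div_mul_left _ _ (pow_ne_zero _ hc)⟩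

lemma exists_rep_map_eq_smul (f : W →ₗ[k] W') (hf : Function.Injective f) (p : ℙ k W) :
    ∃ c : k, c ≠ 0 ∧ (Projectivization.map f hf p).rep = c • f p.rep := by
  obtain ⟨c, hc, hp⟩ := exists_smul_rep (k := k) (f p.rep)
    (fun h0 => p.rep_nonzero (hf (by rw [h0, map_zero])))
  refine ⟨c, hc, ?_⟩
  rw [← hp, ← Projectivization.map_mk f hf _ p.rep_nonzero, p.mk_rep]

/-- A linear isomorphism induces isomorphisms between the subsets that correspond to each other. -/
lemma exists_isIsomorphism_of_linearEquiv (T : W ≃ₗ[k] W')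
    (h : ∀ p, p ∈ Y ↔ Projectivization.map T.toLinearMap T.injective p ∈ Y') :
    ∃ e : Y ≃ Y', IsIsomorphism e ∧
      ∀ p : Y, (e p).1 = Projectivization.map T.toLinearMap T.injective p.1 := by
  have hGF : ∀ p, Projectivization.map T.symm.toLinearMap T.symm.injective
      (Projectivization.map T.toLinearMap T.injective p) = p := by
    intro p
    induction p with
    | h w hw => simp [Projectivization.map_mk]
  have hFG : ∀ p, Projectivization.map T.toLinearMap T.injective
      (Projectivization.map T.symm.toLinearMap T.symm.injective p) = p := by
    intro p
    induction p with
    | h w hw => simp [Projectivization.map_mk]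
  let e : Y ≃ Y' :=
    { toFun := fun p => ⟨Projectivization.map T.toLinearMap T.injective p.1, (h _).1 p.2⟩
      invFun := fun p => ⟨Projectivization.map T.symm.toLinearMap T.symm.injective p.1,
        (h _).2 (by rw [hFG]; exact p.2)⟩
      left_inv := fun p => Subtype.ext (hGF p.1)
      right_inv := fun p => Subtype.ext (hFG p.1) }
  exact ⟨e, ⟨isMorphism_of_linearMap T.toLinearMap _ fun p =>
      exists_rep_map_eq_smul _ T.injective p.1,
    isMorphism_of_linearMap T.symm.toLinearMap _ fun p =>
      exists_rep_map_eq_smul _ T.symm.injective p.1⟩,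
    fun _ => rfl⟩

end Linear

/-! ### Smoothness from affine charts -/

section Chart

variable {Y : Set (ℙ k W)}

lemma eventually_evalAt_ne_zero {m : ℕ} {G : MvPolynomial (Module.Dual k W) k}
    (hG : G.IsHomogeneous m) {y : Y} (hy : evalAt G y.1.rep ≠ 0) :
    ∀ᶠ z : Y in nhds y, evalAt G z.1.rep ≠ 0 :=
  ((isOpen_evalAt_ne_zero hG).preimage continuous_subtype_val).mem_nhds hy

lemma mk_mem_localRing {y : Y} {m : ℕ} {F G : MvPolynomial (Module.Dual k W) k}
    (hF : F.IsHomogeneous m) (hG : G.IsHomogeneous m) (hy : evalAt G y.1.rep ≠ 0) :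
    ((fun z : Y => evalAt F z.1.rep / evalAt G z.1.rep : Y → k) : Filter.Germ (nhds y) k) ∈
      localRing y :=
  ⟨m, F, G, hF, hG, hy, rfl⟩

/-- If the chart `l₀ ≠ 0` of `Y` is the graph `P` of a polynomial map over the affine space with
coordinates `l i / l₀`, then the local rings of `Y` at the points of the chart are those of the
affine space, and therefore regular. -/
lemma isRegularLocalRing_localRing_of_chart [Infinite k] {σ : Type*} [Finite σ] {P : (σ → k) → W}
    (hP : IsPolynomialMap P) (l₀ : Module.Dual k W) (l : σ → Module.Dual k W)
    (h₀ : ∀ a, l₀ (P a) = 1) (hl : ∀ a i, l i (P a) = a i)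
    (hPY : ∀ a (h : P a ≠ 0), Projectivization.mk k (P a) h ∈ Y)
    (hcov : ∀ z ∈ Y, l₀ z.rep ≠ 0 → ∃ c : k, z.rep = c • P fun i => l i z.rep / l₀ z.rep)
    (y : Y) (hy : l₀ y.1.rep ≠ 0) : IsRegularLocalRing (localRing y) := by
  let a : Y → σ → k := fun z i => l i z.1.rep / l₀ z.1.rep
  let φ : MvPolynomial σ k →+* Filter.Germ (nhds y) k :=
    (Filter.Germ.coeRingHom (nhds y)).comp (RingHom.pi fun z : Y => eval (a z))
  have hφ : ∀ f, φ f = ((fun z => eval (a z) f : Y → k) : Filter.Germ (nhds y) k) := fun _ => rfl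
  have hmem : ∀ f, φ f ∈ localRing y := by
    intro f
    induction f using MvPolynomial.induction_on with
    | C c =>
      convert mk_mem_localRing (y := y) (isHomogeneous_C _ c) (isHomogeneous_one _ _) ?_ using 1
      · rw [hφ]
        simp [evalAt]
      · simp [evalAt]
    | add f g hf hg =>
      rw [map_add]
      exact add_mem hf hg
    | mul_X f i hf =>
      rw [map_mul]
      refine mul_mem hf ?_
      convert mk_mem_localRing (y := y) (isHomogeneous_X k (l i)) (isHomogeneous_X k l₀) ?_ using 1
      · rw [hφ]
        simp [evalAt, a]
      · simpa [evalAt] using hy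
  let ψ : MvPolynomial σ k →+* localRing y := φ.codRestrict (localRing y) hmem
  have hψ : ∀ f, (ψ f : Filter.Germ (nhds y) k) = φ f := fun _ => rfl
  -- homogeneous polynomials on `Y` in terms of the coordinates of the chart
  have htrans : ∀ {m F}, IsHomogeneous F m → ∀ f : MvPolynomial σ k,
      (∀ a, evalAt F (P a) = eval a f) → ∀ z : Y, l₀ z.1.rep ≠ 0 →
      evalAt F z.1.rep = l₀ z.1.rep ^ m * eval (a z) f := by
    intro m F hF f hf z hz
    obtain ⟨c, hc⟩ := hcov z.1 z.2 hz
    have h1 : l₀ z.1.rep = c := by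
      conv_lhs => rw [hc]
      simp [h₀]
    have h2 : z.1.rep = c • P (a z) := hc
    rw [h1, ← hf, ← evalAt_smul hF, ← h2]
  have hnear : ∀ᶠ z : Y in nhds y, l₀ z.1.rep ≠ 0 :=
    ((isOpen_dual_ne_zero l₀).preimage continuous_subtype_val).mem_nhds hy
  let I : Ideal (MvPolynomial σ k) := RingHom.ker (eval (a y))
  have hI : I.IsPrime := RingHom.ker_isPrime _
  let : Algebra (MvPolynomial σ k) (localRing y) := ψ.toAlgebra
  have halg : ∀ f, algebraMap (MvPolynomial σ k) (localRing y) f = ψ f := fun _ => rfl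
  have hloc : IsLocalization.AtPrime (localRing y) I := by
    refine ⟨?_, ?_, ?_⟩
    · rintro ⟨f, hf⟩
      have hf : eval (a y) f ≠ 0 := hf
      obtain ⟨m, F, G, hF, hG, hGy, h⟩ := hmem f
      have h1 := Filter.Germ.coe_eq.1 ((hφ f).symm.trans h)
      have hFy : evalAt F y.1.rep ≠ 0 := by
        have : eval (a y) f = evalAt F y.1.rep / evalAt G y.1.rep := h1.self_of_nhds
        rw [this] at hf
        exact fun h0 => hf (by rw [h0, zero_div])
      refine IsUnit.of_mul_eq_one ⟨_, mk_mem_localRing hG hF hFy⟩ ?_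
      apply Subtype.ext
      rw [halg, Subring.coe_mul, hψ, h, ← Filter.Germ.coe_mul, Subring.coe_one,
        ← Filter.Germ.coe_one]
      refine Filter.Germ.coe_eq.2 ?_
      filter_upwards [eventually_evalAt_ne_zero hF hFy, eventually_evalAt_ne_zero hG hGy]
        with z hz hz'
      simp only [Pi.mul_apply, Pi.one_apply]
      field_simp
    · rintro ⟨_, m, F, G, hF, hG, hGy, rfl⟩
      obtain ⟨f, hf⟩ := hP.exists_evalAt F
      obtain ⟨g, hg⟩ := hP.exists_evalAt G
      have hgy : eval (a y) g ≠ 0 := by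
        rw [htrans hG g hg y hy] at hGy
        exact right_ne_zero_of_mul hGy
      refine ⟨⟨f, ⟨g, hgy⟩⟩, ?_⟩
      apply Subtype.ext
      rw [halg, halg, Subring.coe_mul, hψ, hψ, hφ, hφ, ← Filter.Germ.coe_mul]
      refine Filter.Germ.coe_eq.2 ?_
      filter_upwards [eventually_evalAt_ne_zero hG hGy, hnear] with z hz hz'
      simp only [Pi.mul_apply]
      rw [div_mul_eq_mul_div, div_eq_iff hz, htrans hF f hf z hz', htrans hG g hg z hz']
      ring
    · intro f f' h
      have h1 := congrArg Subtype.val h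
      rw [halg, halg, hψ, hψ, hφ, hφ] at h1
      have h2 := Filter.Germ.coe_eq.1 h1
      obtain ⟨O, hO, hOy⟩ := (mem_nhds_subtype _ _ _).1 h2
      obtain ⟨_, ⟨m, F, hF, rfl⟩, hFy, hFO⟩ := isTopologicalBasis.mem_nhds_iff.1 hO
      obtain ⟨g, hg⟩ := hP.exists_evalAt F
      refine ⟨⟨g, fun h0 => hFy ?_⟩, MvPolynomial.funext fun b => ?_⟩
      · rw [htrans hF g hg y hy, show eval (a y) g = 0 from h0, mul_zero]
      · rw [map_mul, map_mul]
        by_cases hb : eval b g = 0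
        · rw [hb, zero_mul, zero_mul]
        have hPb : P b ≠ 0 := by
          intro h0
          simpa [h0] using h₀ b
        -- the point of `Y` with coordinates `b`
        let z : Y := ⟨Projectivization.mk k (P b) hPb, hPY b hPb⟩
        have hz : a z = b := by
          obtain ⟨c, hc, h3⟩ := exists_smul_rep (k := k) (P b) hPb
          ext i
          change l i (Projectivization.mk k (P b) hPb).rep /
            l₀ (Projectivization.mk k (P b) hPb).rep = b i
          rw [h3]
          simp [h₀, hl, hc]
        have h4 : eval (a z) f = eval (a z) f' := by
          refine hOy (hFO ?_ : z.1 ∈ O)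
          exact fun h0 => hb (by rwa [evalAt_rep_mk_eq_zero_iff hF, hg] at h0)
        rw [← hz, h4]
  exact IsRegularLocalRing.of_ringEquiv
    (IsLocalization.algEquiv I.primeCompl (Localization.AtPrime I) (localRing y)).toRingEquiv

end Chart

end ProjVar

/-! ### Duality between multivectors and alternating forms -/

namespace AlternatingMap

variable {k V : Type*} [Field k] [AddCommGroup V] [Module k V]

instance [FiniteDimensional k V] (r : ℕ) : FiniteDimensional k (V [⋀^Fin r]→ₗ[k] k) :=
  Module.Finite.equiv
    (exteriorPower.alternatingMapLinearEquiv (R := k) (M := V) (N := k) (n := r)).symm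

lemma finrank_alternatingMap [FiniteDimensional k V] (r : ℕ) :
    Module.finrank k (V [⋀^Fin r]→ₗ[k] k) = (Module.finrank k V).choose r := by
  rw [(exteriorPower.alternatingMapLinearEquiv (R := k) (M := V) (N := k) (n := r)).finrank_eq]
  exact Subspace.dual_finrank_eq.trans (exteriorPower.finrank_eq k r)

section CurrySum

variable {ι κ N : Type*} [AddCommGroup N] [Module k N]

/-- An alternating map in two blocks of variables as an alternating map in the first block whose
values are alternating maps in the second block. -/
def currySum (D : V [⋀^ι ⊕ κ]→ₗ[k] N) : V [⋀^ι]→ₗ[k] (V [⋀^κ]→ₗ[k] N) where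
  toFun v :=
    { toFun := fun w => D (Sum.elim v w)
      map_update_add' := fun w i x y => by
        classical
        simp only [← Sum.update_elim_inr, D.map_update_add]
      map_update_smul' := fun w i c x => by
        classical
        simp only [← Sum.update_elim_inr, D.map_update_smul]
      map_eq_zero_of_eq' := fun w i j h hij =>
        D.map_eq_zero_of_eq _ (i := Sum.inr i) (j := Sum.inr j) h (by simpa using hij) }
  map_update_add' v i x y := by
    classical
    ext w
    change D _ = D _ + D _
    simp only [← Sum.update_elim_inl, D.map_update_add]
  map_update_smul' v i c x := by
    classical
    ext w
    change D _ = c • D _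
    simp only [← Sum.update_elim_inl, D.map_update_smul]
  map_eq_zero_of_eq' v i j h hij := by
    ext w
    exact D.map_eq_zero_of_eq _ (i := Sum.inl i) (j := Sum.inl j) h (by simpa using hij)

lemma currySum_apply (D : V [⋀^ι ⊕ κ]→ₗ[k] N) (v : ι → V) (w : κ → V) :
    currySum D v w = D (Sum.elim v w) := rfl

end CurrySum

/-- The linear map from `m`-vectors to alternating forms that sends `v₁ ∧ ⋯ ∧ vₘ` to
`w ↦ det (v, w)`. -/
noncomputable def hodgeMap {m r : ℕ} (b : Module.Basis (Fin m ⊕ Fin r) k V) :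
    ⋀[k]^m V →ₗ[k] (V [⋀^Fin r]→ₗ[k] k) :=
  exteriorPower.alternatingMapLinearEquiv (currySum b.det)

lemma hodgeMap_ιMulti {m r : ℕ} (b : Module.Basis (Fin m ⊕ Fin r) k V) (v : Fin m → V)
    (w : Fin r → V) : hodgeMap b (exteriorPower.ιMulti k m v) w = b.det (Sum.elim v w) := by
  rw [hodgeMap, exteriorPower.alternatingMapLinearEquiv_apply_ιMulti, currySum_apply]

lemma hodgeMap_injective {m r : ℕ} (b : Module.Basis (Fin m ⊕ Fin r) k V) :
    Function.Injective (hodgeMap b) := by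
  let B : Module.Basis (Fin (m + r)) k V := b.reindex finSumFinEquiv
  rw [← LinearMap.ker_eq_bot, eq_bot_iff]
  intro u hu
  rw [LinearMap.mem_ker] at hu
  rw [Submodule.mem_bot]
  refine (B.exteriorPower m).ext_elem fun s => ?_
  -- the frame of the basis vectors that do not occur in the multivector with index `s`
  have hcard : ((s : Finset (Fin (m + r)))ᶜ).card = r := by
    rw [Finset.card_compl, Fintype.card_fin, s.2]
    omega
  let g := ((s : Finset (Fin (m + r)))ᶜ).orderEmbOfFin hcard
  have hg : ∀ i, i ∉ s → ∃ j, g j = i := by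
    intro i hi
    have : i ∈ Set.range g := by
      rw [Finset.range_orderEmbOfFin]
      simpa using hi
    exact this
  have hg' : ∀ j, g j ∉ s := by
    intro j
    exact Finset.mem_compl.1 (Finset.orderEmbOfFin_mem _ hcard j)
  have h1 := congrArg (fun A => A (B ∘ g)) (congrArg (hodgeMap b)
    ((B.exteriorPower m).sum_repr u).symm)
  rw [hu] at h1
  simp only [map_sum, map_smul, sum_apply, smul_apply, zero_apply] at h1
  rw [Finset.sum_eq_single s] at h1
  · rw [exteriorPower.basis_apply, exteriorPower.ιMulti_family, hodgeMap_ιMulti,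
      ← Sum.comp_elim] at h1
    have hinj : Function.Injective
        (Sum.elim (Set.powersetCard.ofFinEmbEquiv.symm s) g) := by
      refine Function.Injective.sumElim (RelEmbedding.injective _) g.injective fun i j h => ?_
      refine hg' j ?_
      rw [← h]
      exact (Set.powersetCard.mem_range_ofFinEmbEquiv_symm_iff_mem s _).1 ⟨i, rfl⟩
    have hbij := (Fintype.bijective_iff_injective_and_card _).2 ⟨hinj, by simp⟩
    have hdet := (b.isUnit_det (B.reindex (Equiv.ofBijective _ hbij).symm)).ne_zero
    rw [Module.Basis.coe_reindex, Equiv.symm_symm] at hdet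
    have h2 := (smul_eq_zero.1 h1.symm).resolve_right hdet
    simpa using h2
  · intro t _ hts
    obtain ⟨i, hit, his⟩ := (Set.powersetCard.exists_mem_notMem_iff_ne t s).1 hts
    obtain ⟨j, hj⟩ := hg i his
    obtain ⟨l, hl⟩ := (Set.powersetCard.mem_range_ofFinEmbEquiv_symm_iff_mem t i).2 hit
    rw [exteriorPower.basis_apply, exteriorPower.ιMulti_family, hodgeMap_ιMulti,
      b.det.map_eq_zero_of_eq _ (i := Sum.inl l) (j := Sum.inr j) _ (by simp), smul_zero]
    simp [hj, hl]
  · simp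

lemma hodgeMap_bijective {m r : ℕ} (b : Module.Basis (Fin m ⊕ Fin r) k V) :
    Function.Bijective (hodgeMap b) := by
  have : FiniteDimensional k V := b.finiteDimensional_of_finite
  refine ⟨hodgeMap_injective b, ?_⟩
  refine (LinearMap.injective_iff_surjective_of_finrank_eq_finrank ?_).1 (hodgeMap_injective b)
  rw [finrank_alternatingMap, exteriorPower.finrank_eq, Module.finrank_eq_card_basis b]
  simpa using Nat.choose_symm_add

lemma _root_.exteriorPower.ιMulti_ne_zero {m : ℕ} {v : Fin m → V} (hv : LinearIndependent k v) :
    exteriorPower.ιMulti k m v ≠ 0 := by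
  intro h0
  have h1 := (exteriorPower.ιMulti_family_linearIndependent_field m hv).ne_zero
    ⟨Finset.univ, by simp⟩
  rw [exteriorPower.ιMulti_family] at h1
  have h2 := (exteriorPower.ιMulti k m).map_perm v (Equiv.ofBijective _
    (Finite.injective_iff_bijective.1 (RelEmbedding.injective
      (Set.powersetCard.ofFinEmbEquiv.symm ⟨Finset.univ, by simp⟩))))
  rw [h0, smul_zero] at h2
  exact h1 h2

/-- The form associated to a decomposable multivector has the subspace spanned by its factors as
its radical. -/
lemma radical_hodgeMap_ιMulti {m r : ℕ} (b : Module.Basis (Fin m ⊕ Fin r) k V) {v : Fin m → V}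
    (hv : LinearIndependent k v) :
    (hodgeMap b (exteriorPower.ιMulti k m v)).radical = Submodule.span k (Set.range v) := by
  have : FiniteDimensional k V := b.finiteDimensional_of_finite
  have h1 : hodgeMap b (exteriorPower.ιMulti k m v) ≠ 0 := by
    rw [Ne, ← _root_.map_zero (hodgeMap b), (hodgeMap_injective b).eq_iff]
    exact exteriorPower.ιMulti_ne_zero hv
  refine (Submodule.eq_of_le_of_finrank_quotient_le (Submodule.span_le.2 ?_) ?_).symm
  · rintro _ ⟨i, rfl⟩
    refine mem_radical.2 fun w j => ?_
    rw [hodgeMap_ιMulti]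
    exact b.det.map_eq_zero_of_eq _ (i := Sum.inl i) (j := Sum.inr j) (by simp) (by simp)
  · have h2 := card_le_finrank_quotient_radical h1
    have h3 := (Submodule.span k (Set.range v)).finrank_quotient_add_finrank
    rw [finrank_span_eq_card hv, Module.finrank_eq_card_basis b] at h3
    simp at h2 h3
    omega

end AlternatingMap

namespace ProjVar

open MvPolynomial

/-- Projective spaces are smooth. -/
lemma isSmooth_univ {k W : Type*} [Field k] [Infinite k] [AddCommGroup W] [Module k W]
    [FiniteDimensional k W] : IsSmooth (Set.univ : Set (ℙ k W)) := by
  classical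
  intro y
  let b := Module.finBasis k W
  obtain ⟨i₀, hi₀⟩ : ∃ i, b.coord i y.1.rep ≠ 0 := by
    by_contra! h
    exact y.1.rep_nonzero (b.ext_elem (by simpa using h))
  refine isRegularLocalRing_localRing_of_chart
    (isPolynomialMap_add_sum_smul (b i₀) fun i : {i // i ≠ i₀} => b i) (b.coord i₀)
    (fun i => b.coord i) (fun a => ?_) (fun a i => ?_) (fun _ _ => Set.mem_univ _)
    (fun z _ hz => ⟨b.coord i₀ z.rep, ?_⟩) y hi₀
  · simp only [map_add, map_sum, map_smul, Module.Basis.coord_apply, Module.Basis.repr_self,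
      Finsupp.single_eq_same, smul_eq_mul]
    rw [Finset.sum_eq_zero fun i _ => ?_, add_zero]
    rw [Finsupp.single_eq_of_ne i.2.symm, mul_zero]
  · simp [Finsupp.single_apply, i.2.symm, Subtype.coe_inj]
  · conv_lhs => rw [← b.sum_repr z.rep, Fintype.sum_eq_add_sum_subtype_ne _ i₀]
    rw [smul_add, Finset.smul_sum, Module.Basis.coord_apply]
    refine congrArg _ (Finset.sum_congr rfl fun i _ => ?_)
    rw [Module.Basis.coord_apply] at hz
    simp only [smul_smul, Module.Basis.coord_apply, mul_div_cancel₀ _ hz]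

end ProjVar

/-! ### Determinantal forms -/

namespace AlternatingMap

variable {k V : Type*} [Field k] [AddCommGroup V] [Module k V] {m : ℕ}

/-- The exterior product of the coordinates of a linear map to `kᵐ`. -/
noncomputable def detForm (π : V →ₗ[k] (Fin m → k)) : V [⋀^Fin m]→ₗ[k] k :=
  (Matrix.detRowAlternating (n := Fin m) (R := k)).compLinearMap π

lemma detForm_apply (π : V →ₗ[k] (Fin m → k)) (w : Fin m → V) :
    detForm π w = Matrix.det (Matrix.of fun j => π (w j)) := rfl

lemma detForm_frame {π : V →ₗ[k] (Fin m → k)} {e : Fin m → V}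
    (he : ∀ i, π (e i) = Pi.single i 1) : detForm π e = 1 := by
  have : (Matrix.of fun j => π (e j)) = 1 := by
    ext i j
    simp [he, Matrix.one_apply, Pi.single_apply, eq_comm]
  rw [detForm_apply, this, Matrix.det_one]

lemma detForm_update {π : V →ₗ[k] (Fin m → k)} {e : Fin m → V}
    (he : ∀ i, π (e i) = Pi.single i 1) (i : Fin m) (v : V) :
    detForm π (Function.update e i v) = π v i := by
  have : (Matrix.of fun j => π (Function.update e i v j)) =
      (1 : Matrix (Fin m) (Fin m) k).updateRow i (π v) := by
    ext j l
    by_cases hj : j = i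
    · subst hj
      simp
    · simp [hj, he, Matrix.one_apply, Pi.single_apply, eq_comm]
  rw [detForm_apply, this, ← Matrix.cramer_transpose_apply, Matrix.transpose_one,
    Matrix.cramer_one]
  rfl

lemma ker_le_radical_detForm (π : V →ₗ[k] (Fin m → k)) :
    LinearMap.ker π ≤ (detForm π).radical :=
  ker_le_radical_compLinearMap _ π

lemma finrank_quotient_radical_detForm [FiniteDimensional k V] {π : V →ₗ[k] (Fin m → k)}
    (h : detForm π ≠ 0) : Module.finrank k (V ⧸ (detForm π).radical) = m := by
  refine le_antisymm ?_ (by simpa using card_le_finrank_quotient_radical h)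
  have h1 := Submodule.finrank_mono (ker_le_radical_detForm π)
  have h2 := (detForm π).radical.finrank_quotient_add_finrank
  have h3 := π.finrank_range_add_finrank_ker
  have h4 := (LinearMap.range π).finrank_le
  rw [Module.finrank_fin_fun] at h4
  omega

/-- Decomposable forms are products of their frame forms. -/
lemma eq_detForm_frameForms [FiniteDimensional k V] {θ : V [⋀^Fin (m + 1)]→ₗ[k] k}
    {e : Fin (m + 1) → V} (he : θ e = 1) (h : Module.finrank k (V ⧸ θ.radical) = m + 1) :
    θ = detForm (θ.frameForms e) := by
  have h1 : detForm (θ.frameForms e) e = 1 := detForm_frame (frameForms_frame he)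
  have h2 : detForm (θ.frameForms e) ≠ 0 := by
    intro h0
    rw [h0, zero_apply] at h1
    exact zero_ne_one h1
  obtain ⟨c, hc⟩ := θ.exists_eq_smul h2 (K := θ.radical) le_rfl
    ((ker_frameForms_eq_radical he h).symm.le.trans (ker_le_radical_detForm _)) (by simpa using h)
  have h3 := DFunLike.congr_fun hc e
  rw [he, smul_apply, h1, smul_eq_mul, mul_one] at h3
  rwa [← h3, one_smul] at hc

end AlternatingMap

/-! ### The space of foliations of degree zero -/

namespace Foliation

open AlternatingMap MvPolynomial

variable {k : Type*} [Field k] [Infinite k] {n q : ℕ}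

instance : FiniteDimensional k (projForms k n q 0) :=
  Module.Finite.equiv (constantFormEquiv k n q)

/-- The constant form of a chosen representative of a point of `ℙ H⁰(ℙⁿ, Ω^q(q+1))`. -/
noncomputable def constantForm (p : ℙ k (projForms k n q 0)) :
    (Fin (n + 1) → k) [⋀^Fin (q + 1)]→ₗ[k] k :=
  (constantFormEquiv k n q).symm p.rep

lemma rep_eq_radialContraction (p : ℙ k (projForms k n q 0)) :
    (p.rep : Form k n q) = radialContraction (constantForm p) := by
  rw [← coe_constantFormEquiv, constantForm, LinearEquiv.apply_symm_apply]

lemma constantForm_ne_zero (p : ℙ k (projForms k n q 0)) : constantForm p ≠ 0 := by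
  rw [constantForm, Ne, LinearEquiv.map_eq_zero_iff]
  exact p.rep_nonzero

lemma radical_constantForm_mk {θ : (Fin (n + 1) → k) [⋀^Fin (q + 1)]→ₗ[k] k}
    (h : constantFormEquiv k n q θ ≠ 0) :
    (constantForm (Projectivization.mk k _ h)).radical = θ.radical := by
  obtain ⟨c, hc, h1⟩ := ProjVar.exists_smul_rep (k := k) (W := projForms k n q 0) _ h
  rw [constantForm, h1, map_smul, LinearEquiv.symm_apply_apply, radical_smul hc]

lemma codimGeTwo_sing (hq : 1 ≤ q) (p : ℙ k (projForms k n q 0)) :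
    ProjVar.CodimGeTwo (sing (p.rep : Form k n q)) := by
  have h : sing (p.rep : Form k n q) = {x | x.rep ∈ (constantForm p).radical} := by
    ext x
    simp [sing, rep_eq_radialContraction, mem_radical_iff_cons]
  rw [h]
  refine ProjVar.codimGeTwo_rep_mem ?_
  have := card_le_finrank_quotient_radical (constantForm_ne_zero p)
  simp only [Fintype.card_fin] at this
  omega

lemma mem_Fol_iff (hq : 1 ≤ q) (p : ℙ k (projForms k n q 0)) :
    p ∈ Fol k n q 0 ↔ IsLocallyDecomposable (radialContraction (constantForm p)) ∧
      SatisfiesIntegrability (radialContraction (constantForm p)) := by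
  have h := codimGeTwo_sing hq p
  rw [rep_eq_radialContraction] at h
  change _ ∧ _ ↔ _
  rw [rep_eq_radialContraction]
  exact and_iff_right h

/-- Apart from codimension one in characteristic two, the foliations of degree zero are given by
the decomposable constant forms. -/
lemma mem_Fol_iff_finrank (hq : 1 ≤ q) (h : ringChar k ≠ 2 ∨ 1 < q)
    (p : ℙ k (projForms k n q 0)) : p ∈ Fol k n q 0 ↔
      Module.finrank k ((Fin (n + 1) → k) ⧸ (constantForm p).radical) = q + 1 := by
  rw [mem_Fol_iff hq]
  refine ⟨fun h' => finrank_quotient_radical_eq (constantForm_ne_zero p) hq h h'.1 h'.2,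
    fun h' => ⟨isLocallyDecomposable_of_finrank h'.le, satisfiesIntegrability_of_finrank h'.le⟩⟩

lemma isDefinedByProjection_iff (hq : 1 ≤ q) (p : ℙ k (projForms k n q 0))
    {π : (Fin (n + 1) → k) →ₗ[k] (Fin (q + 1) → k)} (hπ : Function.Surjective π) :
    IsDefinedByProjection (p.rep : Form k n q) π ↔ (constantForm p).radical = LinearMap.ker π := by
  rw [rep_eq_radialContraction,
    isDefinedByProjection_radialContraction_iff (constantForm_ne_zero p) hq hπ]

lemma mem_Fol_iff_exists_projection (hq : 1 ≤ q) (h : ringChar k ≠ 2 ∨ 1 < q)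
    (p : ℙ k (projForms k n q 0)) : p ∈ Fol k n q 0 ↔
      ∃ π : (Fin (n + 1) → k) →ₗ[k] (Fin (q + 1) → k), Function.Surjective π ∧
        IsDefinedByProjection (p.rep : Form k n q) π := by
  rw [mem_Fol_iff_finrank hq h]
  constructor
  · intro hp
    obtain ⟨e, he⟩ := exists_apply_eq_one (constantForm_ne_zero p)
    exact ⟨_, frameForms_surjective he, (isDefinedByProjection_iff hq p
      (frameForms_surjective he)).2 (ker_frameForms_eq_radical he hp).symm⟩
  · rintro ⟨π, hπ, hp⟩
    rw [(isDefinedByProjection_iff hq p hπ).1 hp, (π.quotKerEquivOfSurjective hπ).finrank_eq,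
      Module.finrank_fin_fun]

variable (k n q) in
/-- The value of the constant form associated to a projective form on a tuple of vectors, as a
linear coordinate. -/
noncomputable def evalTuple (w : Fin (q + 1) → Fin (n + 1) → k) :
    Module.Dual k (projForms k n q 0) where
  toFun ω := (constantFormEquiv k n q).symm ω w
  map_add' _ _ := by simp
  map_smul' _ _ := by simp

lemma evalTuple_apply (w : Fin (q + 1) → Fin (n + 1) → k) (ω : projForms k n q 0) :
    evalTuple k n q w ω = (constantFormEquiv k n q).symm ω w := rfl

lemma isClosed_sum_eq_zero {r : ℕ} (w w' : Fin r → Fin (q + 1) → Fin (n + 1) → k) (c : Fin r → k) :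
    IsClosed {p : ℙ k (projForms k n q 0) |
      ∑ j, c j * (constantForm p (w j) * constantForm p (w' j)) = 0} := by
  have h : IsHomogeneous (∑ j, C (c j) * (X (evalTuple k n q (w j)) * X (evalTuple k n q (w' j))) :
      MvPolynomial (Module.Dual k (projForms k n q 0)) k) 2 :=
    IsHomogeneous.sum _ _ _ fun j _ =>
      ((isHomogeneous_X _ _).mul (isHomogeneous_X _ _)).C_mul _
  convert ProjVar.isClosed_evalAt_eq_zero (W := projForms k n q 0) h using 4 with p
  simp [ProjVar.evalAt, evalTuple_apply, constantForm]

/-- The foliations of degree zero are the solutions of quadratic equations. -/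
lemma isClosed_Fol (hq : 1 ≤ q) : IsClosed (Fol k n q 0) := by
  have h : Fol k n q 0 = {p | IsLocallyDecomposable (radialContraction (constantForm p))} ∩
      {p | SatisfiesIntegrability (radialContraction (constantForm p))} :=
    Set.ext fun p => mem_Fol_iff hq p
  rw [h]
  refine IsClosed.inter ?_ ?_
  · simp only [isLocallyDecomposable_radialContraction_iff, Set.ofPred_forall]
    exact isClosed_iInter fun x => isClosed_iInter fun v => isClosed_iInter fun i =>
      isClosed_iInter fun u => isClosed_sum_eq_zero _ _ _
  · simp only [satisfiesIntegrability_radialContraction_iff, Set.ofPred_forall]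
    refine isClosed_iInter fun x => isClosed_iInter fun v => isClosed_iInter fun i =>
      isClosed_iInter fun u => ?_
    simpa only [mul_left_comm _ (q + 1 : k), mul_assoc] using isClosed_sum_eq_zero
      (fun j : Fin (q + 2) => Matrix.vecCons x (Function.update v i (u j)))
      (fun j => j.removeNth u) (fun j => (-1) ^ (j : ℕ) * (q + 1 : k))

/-- The projective form obtained from the product of the rows of a matrix of polynomials, as a
function of the point at which these polynomials are evaluated. -/
noncomputable def matrixForm {σ : Type*}
    (A : Matrix (Fin (q + 1)) (Fin (n + 1)) (MvPolynomial σ k)) (a : σ → k) : projForms k n q 0 :=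
  constantFormEquiv k n q (detForm (A.map (eval a)).mulVecLin)

lemma evalTuple_matrixForm {σ : Type*}
    (A : Matrix (Fin (q + 1)) (Fin (n + 1)) (MvPolynomial σ k)) (a : σ → k)
    (w : Fin (q + 1) → Fin (n + 1) → k) :
    evalTuple k n q w (matrixForm A a) = detForm (A.map (eval a)).mulVecLin w := by
  rw [evalTuple_apply, matrixForm, LinearEquiv.symm_apply_apply]

lemma isPolynomialMap_matrixForm {σ : Type*}
    (A : Matrix (Fin (q + 1)) (Fin (n + 1)) (MvPolynomial σ k)) :
    ProjVar.IsPolynomialMap (matrixForm A) := by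
  refine ProjVar.isPolynomialMap_of_separating (Set.range (evalTuple k n q)) (fun ω hω => ?_) ?_
  · rw [← (constantFormEquiv k n q).symm.map_eq_zero_iff]
    ext w
    exact hω _ ⟨w, rfl⟩
  · rintro _ ⟨w, rfl⟩
    refine ⟨Matrix.det (Matrix.of fun j i => ∑ t, A i t * C (w j t)), fun a => ?_⟩
    rw [evalTuple_matrixForm, detForm_apply, RingHom.map_det]
    congr 1
    ext j i
    simp [Matrix.mulVec, dotProduct]

lemma finrank_matrixForm {σ : Type*}
    {A : Matrix (Fin (q + 1)) (Fin (n + 1)) (MvPolynomial σ k)} {a : σ → k}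
    (h : matrixForm A a ≠ 0) : Module.finrank k ((Fin (n + 1) → k) ⧸
      (constantForm (Projectivization.mk k _ h)).radical) = q + 1 := by
  have h' : constantFormEquiv k n q (detForm (A.map (eval a)).mulVecLin) ≠ 0 := h
  have h1 := radical_constantForm_mk h'
  change (constantForm (Projectivization.mk k (matrixForm A a) h)).radical = _ at h1
  rw [h1]
  exact finrank_quotient_radical_detForm fun h0 => h' (by rw [h0, LinearEquiv.map_zero])

/-- A point given by a decomposable form is the product of its frame forms up to a factor. -/
lemma exists_rep_eq_smul {p : ℙ k (projForms k n q 0)}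
    (hp : Module.finrank k ((Fin (n + 1) → k) ⧸ (constantForm p).radical) = q + 1)
    {e : Fin (q + 1) → Fin (n + 1) → k} (he : constantForm p e ≠ 0) :
    p.rep = constantForm p e • constantFormEquiv k n q
      (detForm (((constantForm p e)⁻¹ • constantForm p).frameForms e)) := by
  have h1 : ((constantForm p e)⁻¹ • constantForm p) e = 1 := by
    rw [AlternatingMap.smul_apply, smul_eq_mul, inv_mul_cancel₀ he]
  rw [← eq_detForm_frameForms h1 (by rwa [radical_smul (inv_ne_zero he)]), map_smul, smul_smul,
    mul_inv_cancel₀ he, one_smul, constantForm, LinearEquiv.apply_symm_apply]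

/-- The matrix whose columns with indices in the range of `f` form a unit matrix and whose other
entries are variables. -/
noncomputable def chartMatrix (k : Type*) [Field k] {n q : ℕ} (f : Fin (q + 1) → Fin (n + 1)) :
    Matrix (Fin (q + 1)) (Fin (n + 1))
      (MvPolynomial {x : Fin (q + 1) × Fin (n + 1) // x.2 ∉ Set.range f} k) := by
  classical
  exact fun i t => if h : t ∉ Set.range f then X ⟨(i, t), h⟩ else if t = f i then 1 else 0

section ChartMatrix

variable {f : Fin (q + 1) → Fin (n + 1)}

omit [Infinite k] in
lemma mulVecLin_chartMatrix_frame (hf : Function.Injective f)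
    (a : {x : Fin (q + 1) × Fin (n + 1) // x.2 ∉ Set.range f} → k) (j : Fin (q + 1)) :
    ((chartMatrix k f).map (eval a)).mulVecLin (Pi.single (f j) 1) = Pi.single j 1 := by
  ext i
  simp [chartMatrix, Pi.single_apply, hf.eq_iff, eq_comm]

omit [Infinite k] in
lemma mulVecLin_chartMatrix_of_notMem
    (a : {x : Fin (q + 1) × Fin (n + 1) // x.2 ∉ Set.range f} → k) (i : Fin (q + 1))
    {t : Fin (n + 1)} (ht : t ∉ Set.range f) :
    ((chartMatrix k f).map (eval a)).mulVecLin (Pi.single t 1) i = a ⟨(i, t), ht⟩ := by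
  have : ¬ ∃ y, f y = t := ht
  simp [chartMatrix, this]

lemma evalTuple_matrixForm_chartMatrix (hf : Function.Injective f)
    (a : {x : Fin (q + 1) × Fin (n + 1) // x.2 ∉ Set.range f} → k) :
    evalTuple k n q (fun i => Pi.single (f i) 1) (matrixForm (chartMatrix k f) a) = 1 := by
  rw [evalTuple_matrixForm]
  exact detForm_frame (mulVecLin_chartMatrix_frame hf a)

end ChartMatrix

/-- The space of decomposable foliations is irreducible, being parametrized by matrices. -/
lemma isIrreducible_Fol (hq : 1 ≤ q) (hqn : q ≤ n) (h : ringChar k ≠ 2 ∨ 1 < q) :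
    IsIrreducible (Fol k n q 0) := by
  have hf := Fin.castLE_injective (Nat.succ_le_succ hqn)
  have hne : matrixForm (chartMatrix k (Fin.castLE (Nat.succ_le_succ hqn))) 0 ≠ 0 := by
    intro h0
    have := evalTuple_matrixForm_chartMatrix (k := k) hf 0
    rw [h0, LinearMap.map_zero] at this
    exact zero_ne_one this
  refine ProjVar.isIrreducible_of_isPolynomialMap (isPolynomialMap_matrixForm
    (Matrix.mvPolynomialX (Fin (q + 1)) (Fin (n + 1)) k))
    ⟨_, (mem_Fol_iff_finrank hq h _).2 (finrank_matrixForm hne)⟩ fun p => ⟨fun hp => ?_, ?_⟩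
  · rw [mem_Fol_iff_finrank hq h] at hp
    obtain ⟨e, he⟩ := exists_apply_eq_one (constantForm_ne_zero p)
    have h1 := exists_rep_eq_smul hp (e := e) (by rw [he]; exact one_ne_zero)
    rw [he, one_smul, inv_one, one_smul] at h1
    let a : Fin (q + 1) × Fin (n + 1) → k :=
      fun x => LinearMap.toMatrix' ((constantForm p).frameForms e) x.1 x.2
    have hA : (Matrix.mvPolynomialX (Fin (q + 1)) (Fin (n + 1)) k).map (eval a) =
        LinearMap.toMatrix' ((constantForm p).frameForms e) := by
      ext i j
      rw [Matrix.map_apply, Matrix.mvPolynomialX_apply, eval_X]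
    have h2 : p.rep = matrixForm (Matrix.mvPolynomialX (Fin (q + 1)) (Fin (n + 1)) k) a := by
      rw [h1, matrixForm, hA, ← Matrix.toLin'_apply', Matrix.toLin'_toMatrix']
    refine ⟨a, h2 ▸ p.rep_nonzero, ?_⟩
    simp only [← h2, Projectivization.mk_rep]
  · rintro ⟨a, ha, rfl⟩
    exact (mem_Fol_iff_finrank hq h _).2 (finrank_matrixForm ha)

lemma isSmooth_Fol (hq : 1 ≤ q) (h : ringChar k ≠ 2 ∨ 1 < q) :
    ProjVar.IsSmooth (Fol k n q 0) := by
  classical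
  intro y
  obtain ⟨f, hf, hfy⟩ : ∃ f : Fin (q + 1) → Fin (n + 1), Function.Injective f ∧
      constantForm y.1 (fun i => Pi.single (f i) 1) ≠ 0 := by
    by_contra! h0
    refine constantForm_ne_zero y.1 ((Pi.basisFun k (Fin (n + 1))).ext_alternating fun f hf => ?_)
    simpa using h0 f hf
  let e : Fin (q + 1) → Fin (n + 1) → k := fun i => Pi.single (f i) 1
  refine ProjVar.isRegularLocalRing_localRing_of_chart
    (isPolynomialMap_matrixForm (chartMatrix k f)) (evalTuple k n q e)
    (fun x => evalTuple k n q (Function.update e x.1.1 (Pi.single x.1.2 1)))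
    (evalTuple_matrixForm_chartMatrix hf) (fun a x => ?_)
    (fun a ha => (mem_Fol_iff_finrank hq h _).2 (finrank_matrixForm ha)) (fun z hz hz0 => ?_) y hfy
  · rw [evalTuple_matrixForm, detForm_update (mulVecLin_chartMatrix_frame hf a),
      mulVecLin_chartMatrix_of_notMem a _ x.2]
  · have hze : constantForm z e ≠ 0 := hz0
    refine ⟨constantForm z e, ?_⟩
    refine (exists_rep_eq_smul ((mem_Fol_iff_finrank hq h _).1 hz) hze).trans ?_
    rw [matrixForm]
    congr 3
    refine (Pi.basisFun k (Fin (n + 1))).ext fun t => ?_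
    rw [Pi.basisFun_apply]
    by_cases ht : t ∈ Set.range f
    · obtain ⟨j, rfl⟩ := ht
      rw [mulVecLin_chartMatrix_frame hf]
      exact frameForms_frame (e := e)
        (by rw [AlternatingMap.smul_apply, smul_eq_mul, inv_mul_cancel₀ hze]) j
    · ext i
      rw [mulVecLin_chartMatrix_of_notMem _ _ ht, frameForms_apply, AlternatingMap.smul_apply, smul_eq_mul,
        inv_mul_eq_div]
      rfl

/-! ### The isomorphism with the Grassmannian -/

variable (k) in
/-- The linear isomorphism from `m`-vectors to projective `q`-forms, for `m = n - q`, that sends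
`v₁ ∧ ⋯ ∧ vₘ` to the form `ω` with `ω_x(w) = det (v, x, w)`. -/
noncomputable def multivectorEquiv {m : ℕ} (hm : m + (q + 1) = n + 1) :
    ⋀[k]^m (Fin (n + 1) → k) ≃ₗ[k] projForms k n q 0 :=
  (LinearEquiv.ofBijective _ (hodgeMap_bijective ((Pi.basisFun k (Fin (n + 1))).reindex
    ((finCongr hm.symm).trans finSumFinEquiv.symm)))).trans (constantFormEquiv k n q)

section

variable {m : ℕ} (hm : m + (q + 1) = n + 1)

lemma radical_multivectorEquiv_ιMulti {v : Fin m → Fin (n + 1) → k}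
    (hv : LinearIndependent k v) : ((constantFormEquiv k n q).symm
      (multivectorEquiv k hm (exteriorPower.ιMulti k m v))).radical =
        Submodule.span k (Set.range v) := by
  rw [multivectorEquiv, LinearEquiv.trans_apply, LinearEquiv.symm_apply_apply]
  exact radical_hodgeMap_ιMulti _ hv

/-- The multivector of a decomposable form is the Plücker point of its radical. -/
lemma isPluckerPoint_map_symm_iff (p : ℙ k (projForms k n q 0))
    {L : Submodule k (Fin (n + 1) → k)} (hL : Module.finrank k L = m) :
    ProjVar.IsPluckerPoint k (Projectivization.map (multivectorEquiv k hm).symm.toLinearMap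
      (multivectorEquiv k hm).symm.injective p) L ↔ (constantForm p).radical = L := by
  have hsub : (Projectivization.map (multivectorEquiv k hm).symm.toLinearMap
      (multivectorEquiv k hm).symm.injective p).submodule =
      Submodule.span k {(multivectorEquiv k hm).symm p.rep} := by
    conv_lhs => rw [← p.mk_rep]
    rfl
  constructor
  · rintro ⟨v, hv, rfl, hp⟩
    rw [hsub] at hp
    obtain ⟨c, hc⟩ := Submodule.mem_span_singleton.1
      (hp ▸ Submodule.mem_span_singleton_self ((multivectorEquiv k hm).symm p.rep))
    have h1 : p.rep = c • multivectorEquiv k hm (exteriorPower.ιMulti k m v) := by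
      rw [← map_smul, hc, LinearEquiv.apply_symm_apply]
    have hc0 : c ≠ 0 := by
      rintro rfl
      exact p.rep_nonzero (by rw [h1, zero_smul])
    rw [constantForm, h1, map_smul, radical_smul hc0, radical_multivectorEquiv_ιMulti hm hv]
  · intro h
    let b := Module.finBasisOfFinrankEq k L hL
    let v : Fin m → Fin (n + 1) → k := fun i => b i
    have hv : LinearIndependent k v := b.linearIndependent.map' L.subtype L.ker_subtype
    have hspan : Submodule.span k (Set.range v) = L := by
      have h1 := congrArg (Submodule.map L.subtype) b.span_eq
      rw [Submodule.map_span, ← Set.range_comp, Submodule.map_subtype_top] at h1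
      exact h1
    refine ⟨v, hv, hspan, ?_⟩
    rw [hsub]
    have hB := radical_multivectorEquiv_ιMulti hm hv
    rw [hspan] at hB
    have hcard : Module.finrank k ((Fin (n + 1) → k) ⧸ L) = Fintype.card (Fin (q + 1)) := by
      have := L.finrank_quotient_add_finrank
      rw [hL, Module.finrank_fin_fun] at this
      rw [Fintype.card_fin]
      omega
    obtain ⟨c, hc⟩ := ((constantFormEquiv k n q).symm
      (multivectorEquiv k hm (exteriorPower.ιMulti k m v))).exists_eq_smul
      (constantForm_ne_zero p) hB.ge h.ge hcard
    rw [constantForm, ← map_smul, (constantFormEquiv k n q).symm.injective.eq_iff,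
      ← LinearEquiv.eq_symm_apply, map_smul] at hc
    rw [hc]
    refine (Submodule.span_singleton_smul_eq (isUnit_iff_ne_zero.2 ?_) _).symm
    rintro rfl
    exact exteriorPower.ιMulti_ne_zero hv (by simpa using hc)

end

end Foliation

namespace Foliation

open AlternatingMap

variable {k : Type*} [Field k] [Infinite k] {n q : ℕ}

/-- Sending a decomposable foliation to the Plücker point of its radical is an isomorphism with
the Grassmannian. -/
lemma exists_isIsomorphism_grassmannian {m : ℕ} (hm : m + (q + 1) = n + 1) (hq : 1 ≤ q)
    (h : ringChar k ≠ 2 ∨ 1 < q) :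
    ∃ e : Fol k n q 0 ≃ ProjVar.grassmannian k (Fin (n + 1) → k) m, ProjVar.IsIsomorphism e ∧
      ∀ (p : Fol k n q 0) (π : (Fin (n + 1) → k) →ₗ[k] (Fin (q + 1) → k)),
        Function.Surjective π → (IsDefinedByProjection (p.1.rep : Form k n q) π ↔
          ProjVar.IsPluckerPoint k (e p).1 (LinearMap.ker π)) := by
  have hdim : ∀ L : Submodule k (Fin (n + 1) → k), Module.finrank k L = m ↔
      Module.finrank k ((Fin (n + 1) → k) ⧸ L) = q + 1 := by
    intro L
    have := L.finrank_quotient_add_finrank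
    rw [Module.finrank_fin_fun] at this
    omega
  have hmem : ∀ p, p ∈ Fol k n q 0 ↔ Projectivization.map (multivectorEquiv k hm).symm.toLinearMap
      (multivectorEquiv k hm).symm.injective p ∈
        ProjVar.grassmannian k (Fin (n + 1) → k) m := by
    intro p
    rw [mem_Fol_iff_finrank hq h, ← hdim]
    refine ⟨fun hp => ⟨_, (isPluckerPoint_map_symm_iff hm p hp).2 rfl⟩, ?_⟩
    rintro ⟨L, hL⟩
    have hLm : Module.finrank k L = m := by
      obtain ⟨v, hv, rfl, -⟩ := hL
      rw [finrank_span_eq_card hv, Fintype.card_fin]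
    rwa [(isPluckerPoint_map_symm_iff hm p hLm).1 hL]
  obtain ⟨e, he, he'⟩ := ProjVar.exists_isIsomorphism_of_linearEquiv _ hmem
  refine ⟨e, he, fun p π hπ => ?_⟩
  rw [he', isDefinedByProjection_iff hq p.1 hπ]
  refine (isPluckerPoint_map_symm_iff hm p.1 ((hdim _).2 ?_)).symm
  rw [(π.quotKerEquivOfSurjective hπ).finrank_eq, Module.finrank_fin_fun]

/-! ### Codimension one in characteristic two -/

lemma extD_rep_eq_zero (h2 : ringChar k = 2) (p : ℙ k (projForms k n 1 0)) :
    extD (p.rep : Form k n 1) = 0 := by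
  have h : (2 : k) = 0 := by
    have := ringChar.Nat.cast_ringChar (R := k)
    rw [h2] at this
    exact_mod_cast this
  rw [rep_eq_radialContraction]
  ext u : 1
  rw [extD_radialContraction, Nat.cast_one, one_add_one_eq_two, h]
  simp

lemma Fol_eq_univ (h2 : ringChar k = 2) : Fol k n 1 0 = Set.univ := by
  refine Set.eq_univ_of_forall fun p => ⟨codimGeTwo_sing le_rfl p, ?_, fun v i => ?_⟩
  · rw [rep_eq_radialContraction, isLocallyDecomposable_radialContraction_iff]
    intro x v i u
    -- the square of a `1`-form vanishes
    have h1 : ∀ y, Function.update v i y = fun _ => y := by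
      intro y
      ext j : 1
      rw [Subsingleton.elim j i, Function.update_self]
    have h3 : ∀ j, Fin.removeNth j u = fun _ => u (1 - j) := by
      intro j
      ext l : 1
      rw [Subsingleton.elim l 0]
      fin_cases j <;> rfl
    simp only [h1, h3]
    simp
    ring
  · rw [extD_rep_eq_zero h2]
    ext u : 1
    rw [wedgeOne_apply]
    simp

end Foliation

/-! ### Classification of the foliations of degree zero -/

theorem mainTheorem3 {k : Type*} [Field k] [IsAlgClosed k] (n q : ℕ) (hn : 3 ≤ n)
    (hq : 1 ≤ q) (hqn : q ≤ n - 1) :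
    -- the characteristic is not two or the codimension is at least two
    ((ringChar k ≠ 2 ∨ 1 < q) →
      -- the foliations of degree zero are exactly those defined by linear projections
      (∀ p : ℙ k (Foliation.projForms k n q 0), p ∈ Foliation.Fol k n q 0 ↔
        ∃ π : (Fin (n + 1) → k) →ₗ[k] (Fin (q + 1) → k), Function.Surjective π ∧
          Foliation.IsDefinedByProjection (p.rep : Foliation.Form k n q) π) ∧
      -- sending a foliation to the centre of the projection is an isomorphism with the
      -- Grassmannian of the linear subspaces of codimension `q + 1`
      ∃ e : Foliation.Fol k n q 0 ≃ ProjVar.grassmannian k (Fin (n + 1) → k) (n - q),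
        ProjVar.IsIsomorphism e ∧
        ∀ (p : Foliation.Fol k n q 0) (π : (Fin (n + 1) → k) →ₗ[k] (Fin (q + 1) → k)),
          Function.Surjective π →
            (Foliation.IsDefinedByProjection (p.1.rep : Foliation.Form k n q) π ↔
              ProjVar.IsPluckerPoint k (e p).1 (LinearMap.ker π))) ∧
    -- characteristic two and codimension one
    (ringChar k = 2 → q = 1 →
      Foliation.Fol k n 1 0 = Set.univ ∧ Foliation.Fol k n 1 0 = Foliation.ClosedFol k n 0) ∧
    -- all cases
    IsLocallyClosed (Foliation.Fol k n q 0) ∧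
    IsIrreducible (Foliation.Fol k n q 0) ∧
    ProjVar.IsSmooth (Foliation.Fol k n q 0) := by
  have hqn' : q ≤ n := by omega
  have hopen : IsLocallyClosed (Foliation.Fol k n q 0) := (Foliation.isClosed_Fol hq).isLocallyClosed
  refine ⟨fun h => ⟨Foliation.mem_Fol_iff_exists_projection hq h,
    Foliation.exists_isIsomorphism_grassmannian (by omega) hq h⟩, fun h2 _ => ?_, hopen, ?_⟩
  · refine ⟨Foliation.Fol_eq_univ h2, ?_⟩
    ext p
    exact ⟨fun hp => ⟨hp, Foliation.extD_rep_eq_zero h2 p⟩, fun hp => hp.1⟩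
  · by_cases h : ringChar k ≠ 2 ∨ 1 < q
    · exact ⟨Foliation.isIrreducible_Fol hq hqn' h, Foliation.isSmooth_Fol hq h⟩
    · obtain ⟨h2, hq1⟩ := not_or.1 h
      obtain rfl : q = 1 := by omega
      have : Nontrivial (Foliation.projForms k n 1 0) := by
        have hpos : 0 < Module.finrank k ((Fin (n + 1) → k) [⋀^Fin (1 + 1)]→ₗ[k] k) := by
          rw [AlternatingMap.finrank_alternatingMap, Module.finrank_fin_fun]
          exact Nat.choose_pos (by omega)
        have := Module.nontrivial_of_finrank_pos hpos
        exact (Foliation.constantFormEquiv k n 1).symm.toEquiv.nontrivial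
      rw [Foliation.Fol_eq_univ (not_not.1 h2)]
      exact ⟨ProjVar.isIrreducible_univ, ProjVar.isSmooth_univ⟩
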